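/- Let $A\neq 0$ be a complex $N\times N$ matrix. Its numerical shadow $P_A$ is the probability measure on $\mathbb{C}$ given by $P_A(S)=\mu\{u\in\Omega_N : (Au,u)\in S\}$ for Borel sets $S$, where $\mu$ is the uniform probability measure on the unit sphere $\Omega_N=\{u\in\mathbb{C}^N:\|u\|=1\}$ and $(Au,u)=u^*Au$. Suppose that $A$ has rotation-invariant shadow, i.e. $P_{e^{i\theta}A}=P_A$ for all real $\theta$, and that the positive eigenvalues of $\operatorname{Re}A=(A+A^*)/2$ are all simple; denote them by $\lambda_1,\dots,\lambda_p$ (so the $\lambda_k$ are distinct and list the positive eigenvalues with multiplicity). Then $P_A$ is absolutely continuous with respect to Lebesgue measure on $\mathbb{C}$, with nonnegative density $z\mapsto f(|z|)$, where $$f(r)=\frac1\pi\sum_{k=1}^{p}\frac{\lambda_k^{2(p-2)}}{\prod_{1\le j\le p,\ j\ne k}(\lambda_k^2-\lambda_j^2)}\,F_N\!\left(\frac{r^2}{\lambda_k^2}\right).$$ Here $F_N$ ($N\ge 2$) is given by $F_2(x)=\frac{1}{2\sqrt{1-x}}$ for $0\le x<1$; for $N\ge3$ and $0<x<1$, $$F_N(x)=\int_x^1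 \frac{N-1}{2}(1-s)^{\frac{N-3}{2}}\;\frac{N-2}{2}\Bigl(1-\frac{x}{s}\Bigr)^{\frac{N-4}{2}}\,\frac{ds}{s};$$ and $F_N(x)=0$ for $x\ge 1$. (For $N\ge3$ this integral diverges at $x=0$; the value of the density at the single point $z=0$ is then immaterial.) -/

import Mathlib

open MeasureTheory
open scoped Matrix

noncomputable section

/-- Lebesgue measure on `ℂ^N` with its Euclidean norm, transported from the product measure. -/
def lebesgueCN (N : ℕ) : Measure (EuclideanSpace ℂ (Fin N)) :=
  (volume : Measure (Fin N → ℂ)).map (WithLp.toLp 2)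

/-- The uniform probability measure `μ` on the unit sphere `Ω_N` of `ℂ^N`: the surface measure
induced by Lebesgue measure, normalised to total mass one. -/
def uniformSphere (N : ℕ) : Measure (Metric.sphere (0 : EuclideanSpace ℂ (Fin N)) 1) :=
  ((lebesgueCN N).toSphere Set.univ)⁻¹ • (lebesgueCN N).toSphere

/-- The quadratic form `(M u, u) = u^* M u`. -/
def quadForm {N : ℕ} (M : Matrix (Fin N) (Fin N) ℂ) (u : EuclideanSpace ℂ (Fin N)) : ℂ :=
  star u.ofLp ⬝ᵥ (M *ᵥ u.ofLp)

/-- The numerical shadow `P_M`: the law of `(M u, u)` for `u` uniform on the unit sphere,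
regarded as a measure on `ℂ` (it is carried by the numerical range of `M`). -/
def numericalShadow {N : ℕ} (M : Matrix (Fin N) (Fin N) ℂ) : Measure ℂ :=
  (uniformSphere N).map
    (fun u : Metric.sphere (0 : EuclideanSpace ℂ (Fin N)) 1 => quadForm M u.val)

/-- `A` has rotation-invariant shadow: `A` and `e^{iθ} A` have the same shadow for all real `θ`. -/
def HasRotationInvariantShadow {N : ℕ} (A : Matrix (Fin N) (Fin N) ℂ) : Prop :=
  ∀ θ : ℝ, numericalShadow (Complex.exp (Complex.I * (θ : ℂ)) • A) = numericalShadow A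

/-- The Hermitian part `Re A = (A + A^*) / 2`. -/
def hermPart {N : ℕ} (A : Matrix (Fin N) (Fin N) ℂ) : Matrix (Fin N) (Fin N) ℂ :=
  (2⁻¹ : ℂ) • (A + Aᴴ)

theorem hermPart_isHermitian {N : ℕ} (A : Matrix (Fin N) (Fin N) ℂ) :
    (hermPart A).IsHermitian := by
  unfold hermPart Matrix.IsHermitian
  simp [Matrix.conjTranspose_smul, Matrix.conjTranspose_add, add_comm]

/-- The positive eigenvalues of `Re A`, repeated according to multiplicity. -/
def posEigenvalues {N : ℕ} (A : Matrix (Fin N) (Fin N) ℂ) : Multiset ℝ :=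
  (Finset.univ.val.map (hermPart_isHermitian A).eigenvalues).filter (fun t => 0 < t)

/-- The function `F_N` on `[0, ∞)`, for `N ≥ 2`. On `[0, 1)` it is `1 / (2 √(1 - x))` for `N = 2`;
for `N ≥ 3` it is `∫_x^1 f(s) g(x / s) ds / s` with `f(s) = ((N-1)/2) (1-s)^((N-3)/2)` and
`g(s) = ((N-2)/2) (1-s)^((N-4)/2)`. It is extended by zero to `x ≥ 1`. -/
def shadowF (N : ℕ) (x : ℝ) : ℝ :=
  if 1 ≤ x then 0
  else if N = 2 then 1 / (2 * √(1 - x))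
  else ∫ s in x..1,
    (((N : ℝ) - 1) / 2 * (1 - s) ^ (((N : ℝ) - 3) / 2)) *
      (((N : ℝ) - 2) / 2 * (1 - x / s) ^ (((N : ℝ) - 4) / 2)) / s

/-- The radial function
`f(r) = (1/π) ∑_k λ_k^(2(p-2)) / ∏_{j ≠ k} (λ_k² - λ_j²) * F_N(r² / λ_k²)`;
the exponent is an integer and equals `-2` when `p = 1`. -/
def radialDensity (N : ℕ) {p : ℕ} (lam : Fin p → ℝ) (r : ℝ) : ℝ :=
  1 / Real.pi * ∑ k : Fin p,
    lam k ^ (2 * ((p : ℤ) - 2)) / (∏ j ∈ Finset.univ.erase k, (lam k ^ 2 - lam j ^ 2)) *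
      shadowF N (r ^ 2 / lam k ^ 2)

/-- `f` is a density of `P` with respect to planar Lebesgue measure on `ℂ`. -/
def IsPlanarDensity (P : Measure ℂ) (f : ℂ → ℝ) : Prop :=
  (∀ z, 0 ≤ f z) ∧ Integrable f volume ∧
    P = volume.withDensity (fun z => ENNReal.ofReal (f z))

end

/-! Everything is read off moments. Integrating `(Hz, z)^m e^{-‖z‖²}` over `ℂ^N`, once in polar
coordinates and once in an eigenbasis of `H = Re A`, shows that the `m`-th moment of `Re z` under
the shadow is `m! (N-1)! / (N+m-1)!` times the coefficient of `X^m` in `1/D`, where `D = det(1 - X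
Re A)` (`integral_re_pow_numericalShadow`). Rotation invariance kills the odd moments, so `D` is
even, the spectrum of `Re A` is symmetric about zero and `D = ∏ (1 - λ_k² X²)`. As the `λ_k²` are
distinct, partial fractions turn the coefficient of `X^{2n}` in `1/D` into a combination of the
powers `λ_k^{2n}` (`coeff_inv_prod_one_sub_sq`).

Rotation invariance also annihilates `∫ z^a conj(z)^b` for `a ≠ b` and expresses `∫ |z|^{2n}`
through the `2n`-th moment of `Re z`. On the other side, for `N ≥ 3`, `shadowF N` is almost
everywhere the density of a product of independent Beta(1, (N-1)/2) and Beta(1, (N-2)/2) variables;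
for `N = 2` the second factor degenerates to the constant 1. By the duplication formula its `n`-th
moment is `4^n n!² (N-1)! / (N+2n-1)!`, exactly what is needed for the shadow and the proposed
density to have the same mixed moments.

Both live on a disc, where moments determine finite measures (`Measure.ext_of_complex_moments`). The
proposed density is a signed sum, so its negative part is first added to the shadow; the resulting
identity of positive measures forces that part to vanish
(`ae_nonneg_and_eq_withDensity_of_moments`). Nonnegativity at every point then follows by continuity
away from the origin, or directly when `p = 1`. -/

/-! ### Generating functions: partial fractions and symmetry of the spectrum. -/

open Polynomial in
/-- Lagrange interpolation of the constant `1` at the points `1 / μ k`. -/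
theorem sum_mul_prod_one_sub_eq_one {K ι : Type*} [Field K] [Fintype ι] [DecidableEq ι] [Nonempty ι]
    (μ : ι → K) (hμ : Function.Injective μ) (h0 : ∀ k, μ k ≠ 0) :
    ∑ k, C (μ k ^ (Fintype.card ι - 1) / ∏ j ∈ Finset.univ.erase k, (μ k - μ j)) *
      ∏ j ∈ Finset.univ.erase k, (1 - C (μ j) * X) = 1 := by
  have hinj : Function.Injective (fun k => (μ k)⁻¹) := fun a b h => hμ (inv_injective h)
  refine Polynomial.eq_of_degrees_lt_of_eval_index_eq (s := Finset.univ) (v := fun k => (μ k)⁻¹)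
    (hinj.injOn) ?_ ?_ ?_
  · refine (degree_sum_le _ _).trans_lt ?_
    refine (Finset.sup_lt_iff (WithBot.bot_lt_coe _)).2 fun k _ => ?_
    refine ((degree_mul_le _ _).trans (add_le_add degree_C_le le_rfl)).trans_lt ?_
    rw [zero_add]
    refine (degree_prod_le _ _).trans_lt ?_
    have h1 : ∀ j ∈ Finset.univ.erase k, (1 - C (μ j) * X : K[X]).degree ≤ ((1 : ℕ) : WithBot ℕ) := by
      intro j _
      refine (degree_sub_le _ _).trans ?_
      refine max_le (degree_one_le.trans (by simp)) ((degree_C_mul_X_le _).trans (by simp))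
    refine (Finset.sum_le_sum h1).trans_lt ?_
    have : 0 < Fintype.card ι := Fintype.card_pos
    rw [Finset.sum_const, Finset.card_erase_of_mem (Finset.mem_univ k), Finset.card_univ, nsmul_eq_mul]
    norm_cast
    omega
  · rw [degree_one]; simpa using Fintype.card_pos (α := ι)
  · intro i _
    rw [eval_finsetSum, Finset.sum_eq_single i]
    · simp only [eval_mul, eval_C, eval_prod, eval_sub, eval_one, eval_X]
      have h1 : ∏ j ∈ Finset.univ.erase i, (1 - μ j * (μ i)⁻¹)
          = (∏ j ∈ Finset.univ.erase i, (μ i - μ j)) / μ i ^ (Fintype.card ι - 1) := by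
        rw [← Finset.card_univ, ← Finset.card_erase_of_mem (Finset.mem_univ i), ← Finset.prod_const,
          ← Finset.prod_div_distrib]
        refine Finset.prod_congr rfl fun j _ => ?_
        field_simp [h0 i]
      rw [h1]
      have h2 : ∏ j ∈ Finset.univ.erase i, (μ i - μ j) ≠ 0 :=
        Finset.prod_ne_zero_iff.2 fun j hj =>
          sub_ne_zero.2 fun h => (Finset.ne_of_mem_erase hj) (hμ h).symm
      have h3 : μ i ^ (Fintype.card ι - 1) ≠ 0 := pow_ne_zero _ (h0 i)
      field_simp
    · intro k _ hk
      simp only [eval_mul, eval_prod]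
      refine mul_eq_zero_of_right _
        (Finset.prod_eq_zero (i := i) (Finset.mem_erase.2 ⟨hk.symm, Finset.mem_univ _⟩) ?_)
      simp [h0 i]
    · simp

-- Partial fractions: dividing the interpolation identity, with `X²` substituted for `X`, by the
-- full product leaves a combination of geometric series in `μ k * X²`.
open PowerSeries in
theorem coeff_inv_prod_one_sub_sq {ι : Type*} [Fintype ι] [DecidableEq ι] [Nonempty ι]
    (μ : ι → ℝ) (hμ : Function.Injective μ) (h0 : ∀ k, μ k ≠ 0) (n : ℕ) :
    coeff (2 * n) (∏ k, (1 - C (μ k) * X ^ 2 : PowerSeries ℝ))⁻¹ =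
      ∑ k, μ k ^ (Fintype.card ι - 1) / (∏ j ∈ Finset.univ.erase k, (μ k - μ j)) * μ k ^ n := by
  set c : ι → ℝ := fun k => μ k ^ (Fintype.card ι - 1) / ∏ j ∈ Finset.univ.erase k, (μ k - μ j)
  set E : ι → PowerSeries ℝ := fun k => PowerSeries.mk fun m => if Even m then μ k ^ (m / 2) else 0
  have hE : ∀ k, E k * (1 - C (μ k) * X ^ 2) = 1 := by
    intro k
    ext m
    rw [mul_sub, mul_one, map_sub, mul_left_comm, coeff_C_mul, coeff_mul_X_pow', coeff_one]
    simp only [E, coeff_mk]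
    rcases m with _ | _ | m
    · simp
    · simp
    · have : (m + 1 + 1) / 2 = m / 2 + 1 := by omega
      simp [Nat.even_add_one, this, pow_succ, mul_comm]
  have hpoly : ∑ k, C (c k) * ∏ j ∈ Finset.univ.erase k, (1 - C (μ j) * X ^ 2 : PowerSeries ℝ) = 1 := by
    have h := congrArg (Polynomial.eval₂RingHom (C (R := ℝ)) (X ^ 2))
      (sum_mul_prod_one_sub_eq_one μ hμ h0)
    simp only [map_sum, map_mul, map_prod, map_sub, map_one, Polynomial.coe_eval₂RingHom,
      Polynomial.eval₂_C, Polynomial.eval₂_X] at h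
    exact h
  have hinv : (∏ k, (1 - C (μ k) * X ^ 2 : PowerSeries ℝ))⁻¹ = ∑ k, C (c k) * E k := by
    rw [PowerSeries.inv_eq_iff_mul_eq_one, Finset.sum_mul]
    · refine Eq.trans ?_ hpoly
      refine Finset.sum_congr rfl fun k _ => ?_
      rw [← Finset.mul_prod_erase _ _ (Finset.mem_univ k), mul_assoc, ← mul_assoc (E k), hE, one_mul]
    · simp [map_prod]
  rw [hinv, map_sum]
  refine Finset.sum_congr rfl fun k _ => ?_
  simp [E, c]

open PowerSeries in
/-- The polynomial `∏ (1 - a X)` and the number of factors determine the family `a`. -/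
theorem map_eq_of_prod_one_sub_eq {ι : Type*} [Fintype ι] (a b : ι → ℝ)
    (h : ∏ i, (1 - C (a i) * X : PowerSeries ℝ) = ∏ i, (1 - C (b i) * X)) :
    Finset.univ.val.map a = Finset.univ.val.map b := by
  have hcoe : ∀ a : ι → ℝ, ((∏ i, (1 - Polynomial.C (a i) * Polynomial.X) : Polynomial ℝ) : PowerSeries ℝ)
      = ∏ i, (1 - C (a i) * X) := by
    intro a
    rw [← Polynomial.coeToPowerSeries.ringHom_apply, map_prod]
    simp
  have h1 : (∏ i, (1 - Polynomial.C (a i) * Polynomial.X) : Polynomial ℝ)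
      = ∏ i, (1 - Polynomial.C (b i) * Polynomial.X) := by
    apply Polynomial.coe_injective
    rw [hcoe, hcoe, h]
  -- Passing to the reciprocal polynomial is where the number of factors enters: zero members of the
  -- family are invisible in `∏ (1 - a X)`.
  have hev : ∀ (a : ι → ℝ) (t : ℝ), t ≠ 0 → (∏ i, (Polynomial.X - Polynomial.C (a i))).eval t =
      t ^ Fintype.card ι * (∏ i, (1 - Polynomial.C (a i) * Polynomial.X) : Polynomial ℝ).eval t⁻¹ := by
    intro a t ht
    rw [Polynomial.eval_prod, Polynomial.eval_prod, ← Finset.card_univ, ← Finset.prod_const,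
      ← Finset.prod_mul_distrib]
    refine Finset.prod_congr rfl fun i _ => ?_
    simp
    field_simp
  have h2 : (∏ i, (Polynomial.X - Polynomial.C (a i)) : Polynomial ℝ)
      = ∏ i, (Polynomial.X - Polynomial.C (b i)) := by
    refine Polynomial.eq_of_infinite_eval_eq _ _ (Set.Infinite.mono ?_ (Set.Ioi_infinite (0 : ℝ)))
    intro t ht
    have ht : t ≠ 0 := ne_of_gt ht
    rw [Set.mem_ofPred_eq, hev a t ht, hev b t ht, h1]
  have h3 : ∀ a : ι → ℝ, (∏ i, (Polynomial.X - Polynomial.C (a i)) : Polynomial ℝ).roots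
      = Finset.univ.val.map a := by
    intro a
    have := Polynomial.roots_multiset_prod_X_sub_C (Finset.univ.val.map a)
    rwa [Multiset.map_map] at this
  rw [← h3, ← h3, h2]

-- A power series with no odd coefficients is fixed by `X ↦ -X`, and so is its inverse; for the
-- product this substitution negates every `a i`.
open PowerSeries in
theorem map_neg_eq_of_coeff_odd {ι : Type*} [Fintype ι] (a : ι → ℝ)
    (h : ∀ m, Odd m → coeff m (∏ i, (1 - C (a i) * X : PowerSeries ℝ))⁻¹ = 0) :
    Finset.univ.val.map (fun i => - a i) = Finset.univ.val.map a := by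
  apply map_eq_of_prod_one_sub_eq
  set D : PowerSeries ℝ := ∏ i, (1 - C (a i) * X) with hD
  have hc : constantCoeff D ≠ 0 := by simp [hD, map_prod]
  have h1 : evalNegHom D⁻¹ = D⁻¹ := by
    ext m
    rw [evalNegHom, coeff_rescale]
    rcases Nat.even_or_odd m with hm | hm
    · simp [hm.neg_one_pow]
    · simp [h m hm]
  have h2 : evalNegHom D = D := by
    have h3 : evalNegHom D * D⁻¹ = 1 := by
      rw [← h1, ← map_mul, PowerSeries.mul_inv_cancel _ hc, map_one]
    calc evalNegHom D = evalNegHom D * (D⁻¹ * D) := by rw [PowerSeries.inv_mul_cancel _ hc, mul_one]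
      _ = D := by rw [← mul_assoc, h3, one_mul]
  refine Eq.trans ?_ h2
  rw [hD, map_prod]
  refine Finset.prod_congr rfl fun i _ => ?_
  rw [map_sub, map_mul, map_one, evalNegHom_X]
  have : evalNegHom (C (a i)) = C (a i) := by
    ext m
    rw [evalNegHom, coeff_rescale, coeff_C]
    split_ifs with h <;> simp [h]
  rw [this, map_neg]
  ring

/-- A multiset of reals that is symmetric about zero consists of its positive members, their
opposites, and zeros. -/
theorem multiset_eq_of_map_neg_eq (S : Multiset ℝ) (h : S.map (fun t => -t) = S) :
    S = S.filter (fun t => 0 < t) + (S.filter (fun t => 0 < t)).map (fun t => -t)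
      + Multiset.replicate (S.count 0) 0 := by
  have h1 : (S.filter (fun t => 0 < t)).map (fun t => -t) = S.filter (fun t => t < 0) := by
    conv_rhs => rw [← h]
    rw [Multiset.filter_map]
    congr 1
    refine Multiset.filter_congr fun x _ => ?_
    simp
  rw [h1]
  ext t
  simp only [Multiset.count_add, Multiset.count_filter, Multiset.count_replicate]
  rcases lt_trichotomy t 0 with ht | ht | ht
  · simp [ht, ht.ne', not_lt.2 ht.le]
  · simp [ht]
  · simp [ht, not_lt.2 ht.le, ht.ne]

-- Opposite members pair up as `(1 - λX)(1 + λX) = 1 - λ²X²`, and zeros contribute the factor 1. The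
-- pairing also bounds `p`, which later guarantees `N ≥ 4` as soon as `p ≥ 2`.
open PowerSeries in
theorem prod_one_sub_of_symmetric {N p : ℕ} (a : Fin N → ℝ) (lam : Fin p → ℝ)
    (hlam : (Finset.univ.val.map a).filter (fun t => 0 < t) = Finset.univ.val.map lam)
    (hsymm : Finset.univ.val.map (fun i => - a i) = Finset.univ.val.map a) :
    2 * p ≤ N ∧ ∏ i, (1 - C (a i) * X : PowerSeries ℝ) = ∏ k, (1 - C (lam k ^ 2) * X ^ 2) := by
  have h := multiset_eq_of_map_neg_eq (Finset.univ.val.map a) (by rw [Multiset.map_map]; exact hsymm)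
  rw [hlam] at h
  constructor
  · have h1 := congrArg Multiset.card h
    simp only [Multiset.card_map, Finset.card_val, Finset.card_univ, Fintype.card_fin,
      Multiset.card_add, Multiset.card_replicate] at h1
    omega
  · have h1 := congrArg (fun S : Multiset ℝ => (S.map (fun t => (1 - C t * X : PowerSeries ℝ))).prod) h
    simp only [Multiset.map_add, Multiset.prod_add, Multiset.map_map, Multiset.map_replicate,
      Multiset.prod_replicate, Function.comp_def] at h1
    refine Eq.trans h1 ?_
    have h2 : ∀ f : Fin p → PowerSeries ℝ, (Finset.univ.val.map f).prod = ∏ k, f k := fun _ => rfl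
    rw [h2, h2, ← Finset.prod_mul_distrib]
    simp only [map_zero, zero_mul, sub_zero, one_pow, mul_one]
    refine Finset.prod_congr rfl fun k _ => ?_
    rw [map_neg, map_pow]
    ring

/-! ### Gaussian integrals. -/

/-- Polar coordinates for a Gaussian integral of a function that is homogeneous of degree `2 m`. -/
theorem integral_homogeneous_mul_exp {E : Type*} [NormedAddCommGroup E] [NormedSpace ℝ E]
    [MeasurableSpace E] [BorelSpace E] [FiniteDimensional ℝ E] [Nontrivial E] (μ : Measure E)
    [μ.IsAddHaarMeasure] (Q : E → ℝ) (hQ : ∀ (r : ℝ) x, Q (r • x) = r ^ 2 * Q x) (m : ℕ) :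
    ∫ x, Q x ^ m * Real.exp (-‖x‖ ^ 2) ∂μ =
      (∫ u : Metric.sphere (0 : E) 1, Q u ^ m ∂μ.toSphere) *
        ∫ r in Set.Ioi (0 : ℝ), r ^ (Module.finrank ℝ E - 1) * (r ^ (2 * m) * Real.exp (-r ^ 2)) :=
  calc
    _ = ∫ x : ({(0)}ᶜ : Set E), Q x.1 ^ m * Real.exp (-‖x.1‖ ^ 2) ∂(μ.comap (↑)) := by
      rw [integral_subtype_comap (measurableSet_singleton _).compl
        fun x ↦ Q x ^ m * Real.exp (-‖x‖ ^ 2), restrict_compl_singleton]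
    _ = ∫ x, Q x.1 ^ m * (x.2.1 ^ (2 * m) * Real.exp (-x.2.1 ^ 2))
          ∂μ.toSphere.prod (.volumeIoiPow (Module.finrank ℝ E - 1)) := by
      rw [← μ.measurePreserving_homeomorphUnitSphereProd.integral_comp
        (Homeomorph.measurableEmbedding _)]
      refine integral_congr_ae (.of_forall fun x => ?_)
      have hx : ‖x.1‖ ≠ 0 := norm_ne_zero_iff.2 x.2
      simp only [homeomorphUnitSphereProd_apply_snd_coe, homeomorphUnitSphereProd_apply_fst_coe, hQ]
      rw [mul_pow, ← pow_mul, inv_pow]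
      field_simp
    _ = (∫ u : Metric.sphere (0 : E) 1, Q u ^ m ∂μ.toSphere) *
        ∫ r : Set.Ioi (0 : ℝ), (r.1 ^ (2 * m) * Real.exp (-r.1 ^ 2))
          ∂.volumeIoiPow (Module.finrank ℝ E - 1) :=
      integral_prod_mul (fun u : Metric.sphere (0 : E) 1 => Q u ^ m)
        (fun r : Set.Ioi (0 : ℝ) => (r.1 ^ (2 * m) * Real.exp (-r.1 ^ 2)))
    _ = _ := by
      congr 1
      simp only [Measure.volumeIoiPow, ENNReal.ofReal]
      rw [integral_withDensity_eq_integral_smul,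
        integral_subtype_comap measurableSet_Ioi fun a ↦
          Real.toNNReal (a ^ (Module.finrank ℝ E - 1)) • (a ^ (2 * m) * Real.exp (-a ^ 2)),
        setIntegral_congr_fun measurableSet_Ioi fun x hx ↦ ?_]
      · rw [NNReal.smul_def, Real.coe_toNNReal _ (pow_nonneg hx.out.le _), smul_eq_mul]
      · exact (measurable_subtype_coe.pow_const _).real_toNNReal

theorem integral_pow_mul_exp_neg_sq (n : ℕ) :
    ∫ r in Set.Ioi (0 : ℝ), r ^ (2 * n + 1) * Real.exp (-r ^ 2) = n.factorial / 2 := by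
  have h := integral_rpow_mul_exp_neg_rpow (p := 2) (q := 2 * n + 1) two_pos
    (by have : (0 : ℝ) ≤ n := n.cast_nonneg
        linarith)
  have h2 : ((2 * n + 1 + 1 : ℝ) / 2) = n + 1 := by ring
  rw [h2, Real.Gamma_nat_eq_factorial] at h
  rw [div_eq_mul_one_div, mul_comm (n.factorial : ℝ), ← h]
  refine setIntegral_congr_fun measurableSet_Ioi fun x hx ↦ ?_
  have : (2 * n + 1 : ℝ) = ((2 * n + 1 : ℕ) : ℝ) := by push_cast; ring
  simp only [this, Real.rpow_natCast, Real.rpow_two]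

theorem Complex.integral_norm_pow_mul_exp_neg_sq (n : ℕ) :
    ∫ z : ℂ, ‖z‖ ^ (2 * n) * Real.exp (-‖z‖ ^ 2) = Real.pi * n.factorial := by
  have h := Complex.integral_rpow_mul_exp_neg_rpow (p := 2) (q := 2 * n) one_le_two
    (by have : (0 : ℝ) ≤ n := n.cast_nonneg
        linarith)
  have h2 : ((2 * n + 2 : ℝ) / 2) = n + 1 := by ring
  rw [h2, Real.Gamma_nat_eq_factorial] at h
  have h3 : 2 * Real.pi / 2 = Real.pi := by ring
  rw [← h3, ← h]
  have : (2 * n : ℝ) = ((2 * n : ℕ) : ℝ) := by push_cast; ring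
  simp only [this, Real.rpow_natCast, Real.rpow_two]

-- A product of geometric series: the coefficients are the complete homogeneous symmetric
-- polynomials.
open PowerSeries in
theorem coeff_inv_prod_one_sub {ι : Type*} [Fintype ι] [DecidableEq ι] (a : ι → ℝ) (m : ℕ) :
    coeff m (∏ i, (1 - C (a i) * X : PowerSeries ℝ))⁻¹ =
      ∑ k ∈ Finset.univ.piAntidiag m, ∏ i, a i ^ k i := by
  have h : (∏ i, (1 - C (a i) * X : PowerSeries ℝ))⁻¹ = ∏ i, PowerSeries.mk (fun n => a i ^ n) := by
    rw [PowerSeries.inv_eq_iff_mul_eq_one (by simp [map_prod]), ← Finset.prod_mul_distrib]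
    refine Finset.prod_eq_one fun i _ => ?_
    ext n
    rw [mul_sub, mul_one, map_sub, mul_left_comm, coeff_C_mul, coeff_mk, coeff_one]
    rcases n with _ | n
    · simp
    · simp [pow_succ, mul_comm]
  rw [h, coeff_prod]
  refine Finset.sum_bij' (fun l _ => ⇑l) (fun k _ => Finsupp.equivFunOnFinite.symm k) ?_ ?_ ?_ ?_ ?_
  · intro l hl
    simpa [Finset.mem_finsuppAntidiag] using hl
  · intro l hl
    simpa [Finset.mem_finsuppAntidiag] using hl
  · intro l _; ext; simp
  · intro l _; ext; simp
  · intro l _; simp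

-- In the multinomial expansion the Gaussian moments `π k_i!` cancel the denominators of the
-- multinomial coefficients, leaving a complete homogeneous symmetric polynomial.
open PowerSeries in
theorem integral_sum_pow_mul_exp {ι : Type*} [Fintype ι] [DecidableEq ι] (a : ι → ℝ) (m : ℕ) :
    ∫ z : ι → ℂ, (∑ i, a i * ‖z i‖ ^ 2) ^ m * Real.exp (-∑ i, ‖z i‖ ^ 2) =
      Real.pi ^ Fintype.card ι * m.factorial *
        coeff m (∏ i, (1 - C (a i) * X : PowerSeries ℝ))⁻¹ := by
  have hint : ∀ n : ℕ, Integrable (fun z : ℂ => ‖z‖ ^ (2 * n) * Real.exp (-‖z‖ ^ 2)) := by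
    intro n
    -- The integral of a non-integrable function is 0 by convention, so a nonzero value proves
    -- integrability.
    apply Integrable.of_integral_ne_zero
    rw [Complex.integral_norm_pow_mul_exp_neg_sq]
    positivity
  have hexpand : ∀ z : ι → ℂ, (∑ i, a i * ‖z i‖ ^ 2) ^ m * Real.exp (-∑ i, ‖z i‖ ^ 2) =
      ∑ k ∈ Finset.univ.piAntidiag m, (Nat.multinomial Finset.univ k * ∏ i, a i ^ k i) *
        ∏ i, (‖z i‖ ^ (2 * k i) * Real.exp (-‖z i‖ ^ 2)) := by
    intro z
    rw [Finset.sum_pow_eq_sum_piAntidiag, Finset.sum_mul, ← Finset.sum_neg_distrib, Real.exp_sum]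
    refine Finset.sum_congr rfl fun k _ => ?_
    simp only [mul_pow, Finset.prod_mul_distrib, pow_mul]
    ring
  simp only [hexpand]
  rw [integral_finsetSum]
  · rw [coeff_inv_prod_one_sub, Finset.mul_sum]
    refine Finset.sum_congr rfl fun k hk => ?_
    rw [integral_const_mul, integral_fintype_prod_volume_eq_prod
      (fun i (z : ℂ) => ‖z‖ ^ (2 * k i) * Real.exp (-‖z‖ ^ 2))]
    simp only [Complex.integral_norm_pow_mul_exp_neg_sq, Finset.prod_mul_distrib, Finset.prod_const,
      Finset.card_univ]
    have h1 := Nat.multinomial_spec Finset.univ k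
    rw [(Finset.mem_piAntidiag.1 hk).1] at h1
    rw [← h1]
    push_cast
    ring
  · intro k _
    exact (Integrable.fintype_prod (f := fun i (z : ℂ) => ‖z‖ ^ (2 * k i) * Real.exp (-‖z‖ ^ 2))
      (fun i => hint _)).const_mul _

/-! ### Moments of a Hermitian form on the unit sphere. -/

instance lebesgueCN.isAddHaarMeasure (N : ℕ) : (lebesgueCN N).IsAddHaarMeasure :=
  ((PiLp.continuousLinearEquiv 2 ℝ (fun _ : Fin N => ℂ)).symm).isAddHaarMeasure_map volume

/-- By uniqueness of Haar measure `lebesgueCN N` is a multiple of the inner-product volume, which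
isometries preserve; the constant is irrelevant. -/
theorem measurePreserving_lebesgueCN {N : ℕ}
    (f : EuclideanSpace ℂ (Fin N) ≃ₗᵢ[ℂ] EuclideanSpace ℂ (Fin N)) :
    MeasurePreserving f (lebesgueCN N) (lebesgueCN N) := by
  let g : EuclideanSpace ℂ (Fin N) ≃ₗᵢ[ℝ] EuclideanSpace ℂ (Fin N) :=
    { f.toLinearEquiv.restrictScalars ℝ with norm_map' := f.norm_map }
  have hg : MeasurePreserving g volume volume := g.measurePreserving
  have h := Measure.isAddLeftInvariant_eq_smul (lebesgueCN N) volume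
  rw [h]
  exact hg.smul_measure _

theorem integral_lebesgueCN {N : ℕ} (f : EuclideanSpace ℂ (Fin N) → ℝ) :
    ∫ z, f z ∂lebesgueCN N = ∫ z : Fin N → ℂ, f (WithLp.toLp 2 z) :=
  integral_map_equiv (MeasurableEquiv.toLp 2 (Fin N → ℂ)) f

theorem quadForm_eq_sum_eigenvalues {N : ℕ} {H : Matrix (Fin N) (Fin N) ℂ} (hH : H.IsHermitian)
    (z : EuclideanSpace ℂ (Fin N)) :
    quadForm H z = ((∑ i, hH.eigenvalues i * ‖hH.eigenvectorBasis.repr z i‖ ^ 2 : ℝ) : ℂ) := by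
  have h1 : quadForm H z = inner ℂ z (Matrix.toEuclideanLin H z) := by
    rw [EuclideanSpace.inner_eq_star_dotProduct, dotProduct_comm]
    rfl
  rw [h1, ← hH.eigenvectorBasis.sum_inner_mul_inner]
  push_cast
  refine Finset.sum_congr rfl fun i _ => ?_
  have h2 : inner ℂ (hH.eigenvectorBasis i) (Matrix.toEuclideanLin H z)
      = (hH.eigenvalues i : ℂ) * inner ℂ (hH.eigenvectorBasis i) z := by
    have hs := (Matrix.isSymmetric_toEuclideanLin_iff.2 hH) (hH.eigenvectorBasis i) z
    rw [← hs]
    have he : Matrix.toEuclideanLin H (hH.eigenvectorBasis i)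
        = (hH.eigenvalues i : ℂ) • hH.eigenvectorBasis i := by
      apply WithLp.ofLp_injective
      have := hH.mulVec_eigenvectorBasis i
      simpa using this
    rw [he, inner_smul_left, Complex.conj_ofReal]
  rw [h2, OrthonormalBasis.repr_apply_apply, mul_left_comm, ← inner_conj_symm z,
    Complex.conj_mul']

theorem quadForm_smul {N : ℕ} (M : Matrix (Fin N) (Fin N) ℂ) (r : ℝ) (z : EuclideanSpace ℂ (Fin N)) :
    quadForm M (r • z) = r ^ 2 * quadForm M z := by
  simp only [quadForm, WithLp.ofLp_smul, Matrix.mulVec_smul, star_smul, smul_dotProduct,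
    dotProduct_smul, star_trivial]
  simp only [Complex.real_smul]
  ring

open PowerSeries in
theorem integral_quadForm_pow_mul_exp {N : ℕ} {H : Matrix (Fin N) (Fin N) ℂ} (hH : H.IsHermitian)
    (m : ℕ) :
    ∫ z, (quadForm H z).re ^ m * Real.exp (-‖z‖ ^ 2) ∂lebesgueCN N =
      Real.pi ^ N * m.factorial *
        coeff m (∏ i, (1 - C (hH.eigenvalues i) * X : PowerSeries ℝ))⁻¹ := by
  have h := (measurePreserving_lebesgueCN hH.eigenvectorBasis.repr).integral_comp
    hH.eigenvectorBasis.repr.toHomeomorph.measurableEmbedding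
    (fun z => (∑ i, hH.eigenvalues i * ‖z i‖ ^ 2) ^ m * Real.exp (-‖z‖ ^ 2))
  have h2 := integral_sum_pow_mul_exp hH.eigenvalues m
  rw [Fintype.card_fin] at h2
  rw [← h2]
  refine Eq.trans ?_ (h.trans ?_)
  · refine integral_congr_ae (.of_forall fun z => ?_)
    simp only [quadForm_eq_sum_eigenvalues hH, Complex.ofReal_re, LinearIsometryEquiv.norm_map]
  · rw [integral_lebesgueCN]
    simp only [EuclideanSpace.norm_sq_eq]

theorem finrank_real_euclideanSpace_complex (N : ℕ) :
    Module.finrank ℝ (EuclideanSpace ℂ (Fin N)) = 2 * N := by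
  rw [finrank_real_of_complex, finrank_euclideanSpace_fin]

/-- The real dimension is `2N`, so the radial factor is `∫ r^{2N-1+2m} e^{-r²} dr`. -/
theorem integral_toSphere_quadForm_pow {N : ℕ} (hN : 0 < N) (H : Matrix (Fin N) (Fin N) ℂ) (m : ℕ) :
    ∫ z, (quadForm H z).re ^ m * Real.exp (-‖z‖ ^ 2) ∂lebesgueCN N =
      (∫ u : Metric.sphere (0 : EuclideanSpace ℂ (Fin N)) 1, (quadForm H u).re ^ m
        ∂(lebesgueCN N).toSphere) * ((N + m - 1).factorial / 2) := by
  have : Nonempty (Fin N) := ⟨⟨0, hN⟩⟩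
  rw [integral_homogeneous_mul_exp (lebesgueCN N) (fun z => (quadForm H z).re),
    finrank_real_euclideanSpace_complex, ← integral_pow_mul_exp_neg_sq]
  · congr 2
    ext r
    rw [← mul_assoc, ← pow_add]
    congr 2
    omega
  · intro r x
    rw [quadForm_smul, ← Complex.ofReal_pow, Complex.re_ofReal_mul]

theorem isProbabilityMeasure_uniformSphere {N : ℕ} (hN : 0 < N) :
    IsProbabilityMeasure (uniformSphere N) := by
  have : Nonempty (Fin N) := ⟨⟨0, hN⟩⟩
  constructor
  rw [uniformSphere, Measure.smul_apply, smul_eq_mul, ENNReal.inv_mul_cancel]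
  · rw [Ne, Measure.measure_univ_eq_zero]
    exact (lebesgueCN N).toSphere_ne_zero
  · exact measure_ne_top _ _

open PowerSeries in
/-- Moments of the quadratic form of a Hermitian matrix over the unit sphere. -/
theorem integral_uniformSphere_quadForm_pow {N : ℕ} (hN : 0 < N) {H : Matrix (Fin N) (Fin N) ℂ}
    (hH : H.IsHermitian) (m : ℕ) :
    ∫ u, (quadForm H u.val).re ^ m ∂uniformSphere N =
      m.factorial * (N - 1).factorial / (N + m - 1).factorial *
        coeff m (∏ i, (1 - C (hH.eigenvalues i) * X : PowerSeries ℝ))⁻¹ := by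
  have h0 := (integral_toSphere_quadForm_pow hN H 0).symm.trans (integral_quadForm_pow_mul_exp hH 0)
  have hm := (integral_toSphere_quadForm_pow hN H m).symm.trans (integral_quadForm_pow_mul_exp hH m)
  have hc : coeff 0 (∏ i, (1 - C (hH.eigenvalues i) * X : PowerSeries ℝ))⁻¹ = 1 := by
    simp [map_prod]
  simp only [pow_zero, integral_const, smul_eq_mul, mul_one, hc, Nat.factorial_zero, Nat.cast_one,
    add_zero] at h0
  rw [uniformSphere, integral_smul_measure, ENNReal.toReal_inv, smul_eq_mul]
  rw [Measure.real] at h0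
  have h1 : ((N + m - 1).factorial : ℝ) ≠ 0 := by positivity
  have h2 : ((N - 1).factorial : ℝ) ≠ 0 := by positivity
  -- The case `m = 0` gives the total mass that normalises the sphere.
  have hS : ((lebesgueCN N).toSphere Set.univ).toReal = 2 * Real.pi ^ N / (N - 1).factorial := by
    field_simp
    linarith
  rw [hS]
  have hI : (∫ u : Metric.sphere (0 : EuclideanSpace ℂ (Fin N)) 1, (quadForm H u).re ^ m
        ∂(lebesgueCN N).toSphere) = 2 * (Real.pi ^ N * m.factorial *
        coeff m (∏ i, (1 - C (hH.eigenvalues i) * X : PowerSeries ℝ))⁻¹) / (N + m - 1).factorial := by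
    rw [← hm]
    field_simp
  rw [hI]
  field_simp

/-! ### Moments of `shadowF`. -/

/-- These are the moments of the Beta(1, c) law. -/
theorem lintegral_pow_mul_one_sub_rpow {c : ℝ} (hc : 0 < c) (n : ℕ) :
    ∫⁻ s in Set.Ioo (0 : ℝ) 1, ENNReal.ofReal (s ^ n * (c * (1 - s) ^ (c - 1))) =
      ENNReal.ofReal (n.factorial * Real.Gamma (c + 1) / Real.Gamma (n + 1 + c)) := by
  have hn : (0 : ℝ) < n + 1 := by positivity
  have h := ProbabilityTheory.lintegral_betaPDF_eq_one hn hc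
  rw [ProbabilityTheory.lintegral_betaPDF] at h
  have hb := ProbabilityTheory.beta_pos hn hc
  have hB : (n.factorial : ℝ) * Real.Gamma (c + 1) / Real.Gamma (n + 1 + c)
      = c * ProbabilityTheory.beta (n + 1) c := by
    rw [ProbabilityTheory.beta, Real.Gamma_nat_eq_factorial, Real.Gamma_add_one hc.ne']
    ring
  rw [hB, ← mul_one (ENNReal.ofReal _), ← h, ← lintegral_const_mul' _ _ ENNReal.ofReal_ne_top]
  refine setLIntegral_congr_fun measurableSet_Ioo fun x hx => ?_
  rw [← ENNReal.ofReal_mul (by positivity), add_sub_cancel_right, Real.rpow_natCast]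
  congr 1
  field_simp

/-- Numerators and denominators are each a pair of Gamma values half a unit apart, so Legendre's
duplication formula applies at `N/2` and at `n + N/2`. -/
theorem Real.Gamma_half_mul_Gamma_ratio {N : ℕ} (hN : 2 ≤ N) (n : ℕ) :
    Real.Gamma (((N : ℝ) - 1) / 2 + 1) / Real.Gamma (n + 1 + ((N : ℝ) - 1) / 2) *
      (Real.Gamma (((N : ℝ) - 2) / 2 + 1) / Real.Gamma (n + 1 + ((N : ℝ) - 2) / 2)) =
      4 ^ n * (N - 1).factorial / (N + 2 * n - 1).factorial := by
  have h1 := Real.Gamma_mul_Gamma_add_half ((N : ℝ) / 2)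
  have h2 := Real.Gamma_mul_Gamma_add_half (n + (N : ℝ) / 2)
  have e1 : ((N : ℝ) - 1) / 2 + 1 = (N : ℝ) / 2 + 1 / 2 := by ring
  have e2 : (n + 1 + ((N : ℝ) - 1) / 2) = n + (N : ℝ) / 2 + 1 / 2 := by ring
  have e3 : ((N : ℝ) - 2) / 2 + 1 = (N : ℝ) / 2 := by ring
  have e4 : (n + 1 + ((N : ℝ) - 2) / 2) = n + (N : ℝ) / 2 := by ring
  have hNpos : (0 : ℝ) < N := by positivity
  have e5 : 2 * ((N : ℝ) / 2) = ((N - 1 : ℕ) : ℝ) + 1 := by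
    rw [Nat.cast_sub (by omega)]; push_cast; ring
  have e6 : 2 * (n + (N : ℝ) / 2) = ((N + 2 * n - 1 : ℕ) : ℝ) + 1 := by
    rw [Nat.cast_sub (by omega)]; push_cast; ring
  rw [e1, e2, e3, e4, div_mul_div_comm, mul_comm (Real.Gamma (_ + 1 / 2)),
    mul_comm (Real.Gamma (_ + 1 / 2)), h1, h2]
  have e7 : (2 : ℝ) ^ (1 - 2 * ((N : ℝ) / 2)) = 2 ^ (1 - 2 * (n + (N : ℝ) / 2)) * 4 ^ n := by
    have : (4 : ℝ) ^ n = 2 ^ (2 * n : ℝ) := by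
      rw [Real.rpow_mul zero_le_two, Real.rpow_natCast]; norm_num
    rw [this, ← Real.rpow_add two_pos]
    congr 1
    ring
  rw [e7, e5, e6, Real.Gamma_nat_eq_factorial, Real.Gamma_nat_eq_factorial]
  have : (0 : ℝ) < 2 ^ (1 - (((N + 2 * n - 1 : ℕ) : ℝ) + 1)) := by positivity
  field_simp

/-- The integrand in the definition of `shadowF`. -/
noncomputable def shadowKernel (N : ℕ) (x s : ℝ) : ℝ :=
  (((N : ℝ) - 1) / 2 * (1 - s) ^ (((N : ℝ) - 3) / 2)) *
      (((N : ℝ) - 2) / 2 * (1 - x / s) ^ (((N : ℝ) - 4) / 2)) / s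

theorem shadowF_eq_integral {N : ℕ} (hN : 3 ≤ N) {x : ℝ} (hx : x < 1) :
    shadowF N x = ∫ s in x..1, shadowKernel N x s := by
  rw [shadowF, if_neg (not_le.2 hx), if_neg (by omega)]
  rfl

theorem shadowF_of_one_le (N : ℕ) {x : ℝ} (hx : 1 ≤ x) : shadowF N x = 0 := by
  rw [shadowF, if_pos hx]

theorem shadowF_two {x : ℝ} (hx : x < 1) : shadowF 2 x = 1 / 2 * (1 - x) ^ ((1 / 2 : ℝ) - 1) := by
  rw [shadowF, if_neg (not_le.2 hx), if_pos rfl, Real.sqrt_eq_rpow]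
  have : (1 / 2 : ℝ) - 1 = - (1 / 2) := by norm_num
  rw [this, Real.rpow_neg (by linarith)]
  field_simp

theorem shadowKernel_nonneg {N : ℕ} (hN : 2 ≤ N) {x s : ℝ} (hs : 0 ≤ s) (hx : x ≤ s)
    (hs1 : s ≤ 1) : 0 ≤ shadowKernel N x s := by
  have hN' : (2 : ℝ) ≤ N := by exact_mod_cast hN
  have h1 : 0 ≤ 1 - x / s := sub_nonneg.2 (div_le_one_of_le₀ hx hs)
  have h2 : 0 ≤ 1 - s := by linarith
  have h3 : 0 ≤ (N : ℝ) - 1 := by linarith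
  have h4 : 0 ≤ (N : ℝ) - 2 := by linarith
  unfold shadowKernel
  positivity

theorem shadowF_nonneg {N : ℕ} (hN : 2 ≤ N) {x : ℝ} (hx : 0 ≤ x) : 0 ≤ shadowF N x := by
  rcases le_or_gt 1 x with h | h
  · rw [shadowF_of_one_le N h]
  rcases hN.eq_or_lt with rfl | hN3
  · rw [shadowF_two h]
    have : 0 ≤ 1 - x := by linarith
    positivity
  · rw [shadowF_eq_integral hN3 h]
    exact intervalIntegral.integral_nonneg h.le fun s hs =>
      shadowKernel_nonneg hN (hx.trans hs.1) hs.1 hs.2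

@[fun_prop]
theorem measurable_shadowKernel (N : ℕ) : Measurable (Function.uncurry (shadowKernel N)) := by
  unfold shadowKernel Function.uncurry
  fun_prop

/-- The lower Lebesgue integral version of `shadowF`. -/
noncomputable def shadowFL (N : ℕ) (x : ℝ) : ENNReal :=
  ∫⁻ s in Set.Ioo (0 : ℝ) 1, ENNReal.ofReal (if x < s then shadowKernel N x s else 0)

theorem measurable_shadowFL_integrand (N : ℕ) : Measurable fun q : ℝ × ℝ =>
    ENNReal.ofReal (if q.1 < q.2 then shadowKernel N q.1 q.2 else 0) :=
  (Measurable.ite (measurableSet_lt measurable_fst measurable_snd) (measurable_shadowKernel N)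
    measurable_const).ennreal_ofReal

theorem measurable_shadowFL (N : ℕ) : Measurable (shadowFL N) :=
  (measurable_shadowFL_integrand N).lintegral_prod_right'

theorem shadowF_eq_toReal {N : ℕ} (hN : 3 ≤ N) {x : ℝ} (hx : x ∈ Set.Ioo (0 : ℝ) 1) :
    shadowF N x = (shadowFL N x).toReal := by
  rw [shadowF_eq_integral hN hx.2, intervalIntegral.integral_of_le hx.2.le, integral_Ioc_eq_integral_Ioo,
    shadowFL, integral_eq_lintegral_of_nonneg_ae]
  · congr 1
    have : Set.Ioo x 1 = Set.Ioi x ∩ Set.Ioo 0 1 := by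
      ext s; simp only [Set.mem_Ioo, Set.mem_inter_iff, Set.mem_Ioi]
      constructor
      · rintro ⟨h1, h2⟩; exact ⟨h1, hx.1.trans h1, h2⟩
      · rintro ⟨h1, _, h2⟩; exact ⟨h1, h2⟩
    rw [this, ← Measure.restrict_restrict measurableSet_Ioi, ← lintegral_indicator measurableSet_Ioi]
    refine lintegral_congr fun s => ?_
    simp only [Set.indicator, Set.mem_Ioi]
    split_ifs <;> simp
  · refine ae_restrict_of_forall_mem measurableSet_Ioo fun s hs => ?_
    exact shadowKernel_nonneg (by omega) (hx.1.trans hs.1).le hs.1.le hs.2.le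
  · exact ((measurable_shadowKernel N).comp measurable_prodMk_left).aestronglyMeasurable

theorem setLIntegral_Ioo_zero_eq {s : ℝ} (hs : 0 < s) (g : ℝ → ENNReal) :
    ∫⁻ x in Set.Ioo 0 s, g x = ∫⁻ y in Set.Ioo (0 : ℝ) 1, ENNReal.ofReal s * g (s * y) := by
  have himg : (fun y => s * y) '' Set.Ioo (0 : ℝ) 1 = Set.Ioo 0 s := by
    rw [Set.image_mul_left_Ioo hs]; simp
  rw [← himg, lintegral_image_eq_lintegral_abs_deriv_mul (f' := fun _ => s) measurableSet_Ioo]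
  · simp only [abs_of_pos hs]
  · intro x _
    simpa using ((hasDerivAt_id x).const_mul s).hasDerivWithinAt
  · exact (mul_right_injective₀ hs.ne').injOn

/-- The kernel is a multiplicative convolution: after Tonelli, the substitution `x = s y` splits the
moment into two Beta moments. Working in `ENNReal` avoids any prior integrability. -/
theorem lintegral_pow_mul_shadowFL {N : ℕ} (hN : 3 ≤ N) (n : ℕ) :
    ∫⁻ x in Set.Ioo (0 : ℝ) 1, ENNReal.ofReal (x ^ n) * shadowFL N x =
      ENNReal.ofReal (4 ^ n * n.factorial ^ 2 * (N - 1).factorial / (N + 2 * n - 1).factorial) := by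
  have hN' : (3 : ℝ) ≤ N := by exact_mod_cast hN
  have hc1 : (0 : ℝ) < ((N : ℝ) - 1) / 2 := by linarith
  have hc2 : (0 : ℝ) < ((N : ℝ) - 2) / 2 := by linarith
  have hx1 : ((N : ℝ) - 1) / 2 - 1 = ((N : ℝ) - 3) / 2 := by ring
  have hx2 : ((N : ℝ) - 2) / 2 - 1 = ((N : ℝ) - 4) / 2 := by ring
  have hb1 := lintegral_pow_mul_one_sub_rpow hc1 n
  have hb2 := lintegral_pow_mul_one_sub_rpow hc2 n
  rw [hx1] at hb1
  rw [hx2] at hb2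
  have hmeas : Measurable (Function.uncurry fun x s : ℝ => ENNReal.ofReal (x ^ n) *
      ENNReal.ofReal (if x < s then shadowKernel N x s else 0)) :=
    Measurable.mul (by fun_prop) (measurable_shadowFL_integrand N)
  have hinner : ∀ s ∈ Set.Ioo (0 : ℝ) 1, ∫⁻ x in Set.Ioo (0 : ℝ) 1, ENNReal.ofReal (x ^ n) *
      ENNReal.ofReal (if x < s then shadowKernel N x s else 0) =
      ENNReal.ofReal (s ^ n * (((N : ℝ) - 1) / 2 * (1 - s) ^ (((N : ℝ) - 3) / 2))) *
        ENNReal.ofReal (n.factorial * Real.Gamma (((N : ℝ) - 2) / 2 + 1) /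
          Real.Gamma (n + 1 + ((N : ℝ) - 2) / 2)) := by
    intro s hs
    have hset : Set.Ioo (0 : ℝ) s = Set.Iio s ∩ Set.Ioo 0 1 := by
      ext x; simp only [Set.mem_Ioo, Set.mem_inter_iff, Set.mem_Iio]
      constructor
      · rintro ⟨h1, h2⟩; exact ⟨h2, h1, h2.trans hs.2⟩
      · rintro ⟨h1, h2, _⟩; exact ⟨h2, h1⟩
    have h1 : ∫⁻ x in Set.Ioo (0 : ℝ) 1, ENNReal.ofReal (x ^ n) *
      ENNReal.ofReal (if x < s then shadowKernel N x s else 0) =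
      ∫⁻ x in Set.Ioo (0 : ℝ) s, ENNReal.ofReal (x ^ n) * ENNReal.ofReal (shadowKernel N x s) := by
      rw [hset, ← Measure.restrict_restrict measurableSet_Iio,
        ← lintegral_indicator measurableSet_Iio]
      refine lintegral_congr fun s => ?_
      simp only [Set.indicator, Set.mem_Iio]
      split_ifs <;> simp
    rw [h1, setLIntegral_Ioo_zero_eq hs.1, ← hb2, ← lintegral_const_mul' _ _ ENNReal.ofReal_ne_top]
    refine setLIntegral_congr_fun measurableSet_Ioo fun y hy => ?_
    have hs0 : s ≠ 0 := hs.1.ne'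
    have h1s : 0 ≤ 1 - s := by linarith [hs.2]
    have hsp := hs.1.le
    have hyp := hy.1.le
    rw [← ENNReal.ofReal_mul (by positivity), ← ENNReal.ofReal_mul (by positivity),
      ← ENNReal.ofReal_mul (by positivity), shadowKernel, mul_div_cancel_left₀ _ hs0, mul_pow]
    congr 1
    field_simp
  simp only [shadowFL]
  calc _ = ∫⁻ x in Set.Ioo (0 : ℝ) 1, ∫⁻ s in Set.Ioo (0 : ℝ) 1, ENNReal.ofReal (x ^ n) *
      ENNReal.ofReal (if x < s then shadowKernel N x s else 0) := by
        refine lintegral_congr fun x => ?_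
        rw [lintegral_const_mul' _ _ ENNReal.ofReal_ne_top]
    _ = ∫⁻ s in Set.Ioo (0 : ℝ) 1, ∫⁻ x in Set.Ioo (0 : ℝ) 1, ENNReal.ofReal (x ^ n) *
      ENNReal.ofReal (if x < s then shadowKernel N x s else 0) :=
        lintegral_lintegral_swap hmeas.aemeasurable
    _ = _ := by
      rw [setLIntegral_congr_fun measurableSet_Ioo hinner,
        lintegral_mul_const' _ _ ENNReal.ofReal_ne_top, hb1, ← ENNReal.ofReal_mul (by positivity)]
      congr 1
      have := Real.Gamma_half_mul_Gamma_ratio (N := N) (by omega) n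
      calc _ = (n.factorial : ℝ) ^ 2 * (Real.Gamma (((N : ℝ) - 1) / 2 + 1) /
            Real.Gamma (n + 1 + ((N : ℝ) - 1) / 2) *
            (Real.Gamma (((N : ℝ) - 2) / 2 + 1) / Real.Gamma (n + 1 + ((N : ℝ) - 2) / 2))) := by ring
        _ = _ := by rw [this]; ring

theorem ae_shadowFL_ne_top {N : ℕ} (hN : 3 ≤ N) :
    ∀ᵐ x ∂volume.restrict (Set.Ioo (0 : ℝ) 1), shadowFL N x < ⊤ := by
  refine ae_lt_top (measurable_shadowFL N) ?_
  have := lintegral_pow_mul_shadowFL hN 0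
  simp only [pow_zero, ENNReal.ofReal_one, one_mul] at this
  rw [this]
  exact ENNReal.ofReal_ne_top

theorem lintegral_pow_mul_shadowF {N : ℕ} (hN : 2 ≤ N) (n : ℕ) :
    ∫⁻ x in Set.Ioo (0 : ℝ) 1, ENNReal.ofReal (x ^ n * shadowF N x) =
      ENNReal.ofReal (4 ^ n * n.factorial ^ 2 * (N - 1).factorial / (N + 2 * n - 1).factorial) := by
  rcases hN.eq_or_lt with rfl | hN3
  -- For `N = 2` only the Beta(1, 1/2) factor remains; the other Gamma quotient is `1 / n!`.
  · have h := lintegral_pow_mul_one_sub_rpow (c := 1 / 2) (by norm_num) n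
    have h2 := Real.Gamma_half_mul_Gamma_ratio le_rfl n
    refine Eq.trans (setLIntegral_congr_fun measurableSet_Ioo fun x hx => ?_) (h.trans ?_)
    · rw [shadowF_two hx.2]
    · congr 1
      norm_num at h2 ⊢
      rw [Real.Gamma_nat_eq_factorial] at h2
      have : (n.factorial : ℝ) ≠ 0 := by positivity
      field_simp at h2 ⊢
      exact h2
  · rw [← lintegral_pow_mul_shadowFL hN3]
    refine lintegral_congr_ae ?_
    filter_upwards [ae_shadowFL_ne_top hN3, ae_restrict_mem measurableSet_Ioo] with x hx hx1
    rw [ENNReal.ofReal_mul (pow_nonneg hx1.1.le n), shadowF_eq_toReal hN3 hx1,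
      ENNReal.ofReal_toReal hx.ne]

theorem aestronglyMeasurable_shadowF {N : ℕ} (hN : 2 ≤ N) :
    AEStronglyMeasurable (shadowF N) (volume.restrict (Set.Ioi (0 : ℝ))) := by
  have h : AEStronglyMeasurable (shadowF N) (volume.restrict (Set.Ioo (0 : ℝ) 1)) := by
    rcases hN.eq_or_lt with rfl | hN3
    · refine AEStronglyMeasurable.congr
        (f := fun x => 1 / 2 * (1 - x) ^ ((1 / 2 : ℝ) - 1)) (Measurable.aestronglyMeasurable (by fun_prop)) ?_
      filter_upwards [ae_restrict_mem measurableSet_Ioo] with x hx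
      rw [shadowF_two hx.2]
    · refine AEStronglyMeasurable.congr
        (measurable_shadowFL N).ennreal_toReal.aestronglyMeasurable ?_
      filter_upwards [ae_restrict_mem measurableSet_Ioo] with x hx
      rw [shadowF_eq_toReal hN3 hx]
  have h2 : AEStronglyMeasurable (shadowF N) (volume.restrict (Set.Ici (1 : ℝ))) := by
    refine AEStronglyMeasurable.congr (f := fun _ => 0) (by fun_prop) ?_
    filter_upwards [ae_restrict_mem measurableSet_Ici] with x hx
    rw [shadowF_of_one_le N hx]
  rw [← Set.Ioo_union_Ici_eq_Ioi one_pos]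
  exact aestronglyMeasurable_union_iff.2 ⟨h, h2⟩

theorem lintegral_Ioi_pow_mul_shadowF {N : ℕ} (hN : 2 ≤ N) (n : ℕ) :
    ∫⁻ x in Set.Ioi (0 : ℝ), ENNReal.ofReal (x ^ n * shadowF N x) =
      ENNReal.ofReal (4 ^ n * n.factorial ^ 2 * (N - 1).factorial / (N + 2 * n - 1).factorial) := by
  rw [← lintegral_pow_mul_shadowF hN, ← Set.Ioo_union_Ici_eq_Ioi one_pos,
    lintegral_union measurableSet_Ici]
  · rw [setLIntegral_eq_zero measurableSet_Ici, add_zero]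
    intro x hx
    simp [shadowF_of_one_le N hx]
  · rw [Set.disjoint_left]
    intro x hx hx'
    exact absurd hx.2 (not_lt.2 hx')

theorem integrableOn_shadowF {N : ℕ} (hN : 2 ≤ N) : IntegrableOn (shadowF N) (Set.Ioi (0 : ℝ)) := by
  refine ⟨aestronglyMeasurable_shadowF hN, ?_⟩
  rw [hasFiniteIntegral_iff_ofReal]
  · have := lintegral_Ioi_pow_mul_shadowF hN 0
    simp only [pow_zero, one_mul] at this
    rw [this]
    exact ENNReal.ofReal_lt_top
  · exact ae_restrict_of_forall_mem measurableSet_Ioi fun x hx => shadowF_nonneg hN (le_of_lt hx)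

theorem integral_pow_mul_shadowF {N : ℕ} (hN : 2 ≤ N) (n : ℕ) :
    ∫ x in Set.Ioi (0 : ℝ), x ^ n * shadowF N x =
      4 ^ n * n.factorial ^ 2 * (N - 1).factorial / (N + 2 * n - 1).factorial := by
  rw [integral_eq_lintegral_of_nonneg_ae, lintegral_Ioi_pow_mul_shadowF hN, ENNReal.toReal_ofReal]
  · positivity
  · exact ae_restrict_of_forall_mem measurableSet_Ioi fun x hx =>
      mul_nonneg (pow_nonneg (le_of_lt hx) n) (shadowF_nonneg hN (le_of_lt hx))
  · exact AEStronglyMeasurable.mul (by fun_prop) (aestronglyMeasurable_shadowF hN)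

/-! ### Pointwise behaviour of `shadowF`. -/

/-- For `N ≥ 4` both exponents in the kernel are nonnegative, so the powers are at most 1 and only
`1/s` needs control; for `x > x₀/2` it is at most `2/x₀`. Dominated convergence applies. -/
theorem continuousAt_shadowF {N : ℕ} (hN : 4 ≤ N) {x₀ : ℝ} (hx₀ : 0 < x₀) :
    ContinuousAt (shadowF N) x₀ := by
  have hN' : (4 : ℝ) ≤ N := by exact_mod_cast hN
  set g : ℝ → ℝ → ℝ := fun x s => if x < s ∧ s ≤ 1 then shadowKernel N x s else 0 with hg
  have heq : ∀ x, 0 < x → shadowF N x = ∫ s, g x s := by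
    intro x hx
    have h1 : g x = (Set.Ioc x 1).indicator (shadowKernel N x) := by
      ext s; simp [hg, Set.indicator]
    rw [h1, integral_indicator measurableSet_Ioc]
    rcases lt_or_ge x 1 with h | h
    · rw [shadowF_eq_integral (by omega) h, intervalIntegral.integral_of_le h.le]
    · rw [shadowF_of_one_le N h, Set.Ioc_eq_empty (not_lt.2 h)]; simp
  have hev : shadowF N =ᶠ[nhds x₀] fun x => ∫ s, g x s := by
    filter_upwards [lt_mem_nhds hx₀] with x hx using heq x hx
  rw [continuousAt_congr hev]
  refine continuousAt_of_dominated (bound := (Set.Ioc (x₀ / 2) 1).indicator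
    fun _ => ((N : ℝ) - 1) / 2 * (((N : ℝ) - 2) / 2) / (x₀ / 2)) ?_ ?_ ?_ ?_
  · refine .of_forall fun x => Measurable.aestronglyMeasurable ?_
    exact Measurable.ite (measurableSet_Ioc (a := x) (b := 1))
      ((measurable_shadowKernel N).comp measurable_prodMk_left) measurable_const
  · filter_upwards [lt_mem_nhds (half_lt_self hx₀)] with x hx
    refine .of_forall fun s => ?_
    simp only [hg]
    by_cases hs : x < s ∧ s ≤ 1
    · have hmem : s ∈ Set.Ioc (x₀ / 2) 1 := ⟨hx.trans hs.1, hs.2⟩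
      rw [if_pos hs, Set.indicator_of_mem hmem]
      have hx0 : 0 < x := (half_pos hx₀).trans hx
      have hs0 : 0 < s := hx0.trans hs.1
      rw [Real.norm_of_nonneg (shadowKernel_nonneg (by omega) hs0.le hs.1.le hs.2), shadowKernel]
      have hxs : 0 ≤ 1 - x / s := sub_nonneg.2 (div_le_one_of_le₀ hs.1.le hs0.le)
      have b1 : (1 - s) ^ (((N : ℝ) - 3) / 2) ≤ 1 :=
        Real.rpow_le_one (by linarith [hs.2]) (by linarith) (by linarith)
      have b2 : (1 - x / s) ^ (((N : ℝ) - 4) / 2) ≤ 1 :=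
        Real.rpow_le_one hxs (by linarith [div_pos hx0 hs0]) (by linarith)
      have c1 : 0 ≤ ((N : ℝ) - 1) / 2 := by linarith
      have c2 : 0 ≤ ((N : ℝ) - 2) / 2 := by linarith
      have d2 : 0 ≤ (1 - x / s) ^ (((N : ℝ) - 4) / 2) := Real.rpow_nonneg hxs _
      have hs2 : x₀ / 2 ≤ s := (hx.trans hs.1).le
      gcongr
      · exact mul_le_of_le_one_right c1 b1
      · exact mul_le_of_le_one_right c2 b2
    · rw [if_neg hs, norm_zero]
      refine Set.indicator_nonneg (fun _ _ => ?_) _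
      have c1 : 0 ≤ ((N : ℝ) - 1) / 2 := by linarith
      have c2 : 0 ≤ ((N : ℝ) - 2) / 2 := by linarith
      positivity
  · exact (integrable_indicator_iff measurableSet_Ioc).2 (integrableOn_const (by simp))
  -- The cutoff `x < s` jumps at `x₀` only for `s = x₀`, a null set.
  · have : ∀ᵐ s : ℝ, s ≠ x₀ := by simp [ae_iff]
    filter_upwards [this] with s hs
    rcases lt_or_gt_of_ne hs with h | h
    · have : (fun x => g x s) =ᶠ[nhds x₀] fun _ => 0 := by
        filter_upwards [lt_mem_nhds h] with x hx
        simp [hg, not_lt.2 hx.le]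
      exact (continuousAt_congr this).2 continuousAt_const
    · have : (fun x => g x s) =ᶠ[nhds x₀] fun x => if s ≤ 1 then shadowKernel N x s else 0 := by
        filter_upwards [gt_mem_nhds h] with x hx
        simp [hg, hx]
      refine (continuousAt_congr this).2 ?_
      split_ifs
      · unfold shadowKernel
        have h1 : 1 - x₀ / s ≠ 0 :=
          (sub_pos.2 ((div_lt_one (hx₀.trans h)).2 h)).ne'
        have h2 : ContinuousAt (fun x => (1 - x / s) ^ (((N : ℝ) - 4) / 2)) x₀ :=
          ContinuousAt.rpow_const (by fun_prop) (Or.inl h1)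
        exact ((h2.const_mul _).const_mul _).div_const _
      · exact continuousAt_const

/-- At `x = 0` the kernel dominates a multiple of `1/s` near 0, so the integral diverges and takes
its default value. -/
theorem shadowF_zero {N : ℕ} (hN : 3 ≤ N) : shadowF N 0 = 0 := by
  have hN' : (3 : ℝ) ≤ N := by exact_mod_cast hN
  rw [shadowF_eq_integral hN one_pos]
  apply intervalIntegral.integral_undef
  intro h
  have h1 : IntervalIntegrable (shadowKernel N 0) volume 0 (1 / 2) :=
    h.mono_set (by rw [Set.uIcc_of_le, Set.uIcc_of_le] <;> [gcongr; norm_num; norm_num]; norm_num)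
  set c : ℝ := ((N : ℝ) - 1) / 2 * (1 / 2) ^ (((N : ℝ) - 3) / 2) * (((N : ℝ) - 2) / 2) with hc
  have e1 : 0 < ((N : ℝ) - 1) / 2 := by linarith
  have e2 : 0 < ((N : ℝ) - 2) / 2 := by linarith
  have hcpos : 0 < c := by positivity
  have h2 : IntervalIntegrable (fun s : ℝ => s⁻¹) volume 0 (1 / 2) := by
    refine (h1.const_mul c⁻¹).mono_fun' (by fun_prop) ?_
    rw [Set.uIoc_of_le (by norm_num)]
    refine ae_restrict_of_forall_mem measurableSet_Ioc fun s hs => ?_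
    have hs0 := hs.1
    simp only [shadowKernel, zero_div, sub_zero, Real.one_rpow, mul_one]
    rw [Real.norm_of_nonneg (by positivity), inv_mul_eq_div, le_div_iff₀ hcpos, ← div_eq_inv_mul]
    have e3 : (1 / 2 : ℝ) ^ (((N : ℝ) - 3) / 2) ≤ (1 - s) ^ (((N : ℝ) - 3) / 2) :=
      Real.rpow_le_rpow (by norm_num) (by linarith [hs.2]) (by linarith)
    rw [hc]
    gcongr
  rw [intervalIntegrable_inv_iff] at h2
  norm_num at h2

/-! ### Planar measures, their moments and rotations. -/

open scoped ComplexConjugate in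
/-- A finite measure carried by a disc is determined by its moments `∫ z^a conj(z)^b`. -/
theorem Measure.ext_of_complex_moments {P P' : Measure ℂ} [IsFiniteMeasure P] [IsFiniteMeasure P']
    (R : ℝ) (hP : P (Metric.closedBall 0 R)ᶜ = 0) (hP' : P' (Metric.closedBall 0 R)ᶜ = 0)
    (h : ∀ a b : ℕ, ∫ z, z ^ a * (conj z) ^ b ∂P = ∫ z, z ^ a * (conj z) ^ b ∂P') : P = P' := by
  set K : Set ℂ := Metric.closedBall 0 R with hK
  have hKm : MeasurableSet K := Metric.isClosed_closedBall.measurableSet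
  have hcomp : CompactSpace K := isCompact_iff_compactSpace.1 (isCompact_closedBall 0 R)
  have hrestr : ∀ Q : Measure ℂ, Q Kᶜ = 0 → Q.restrict K = Q := fun Q hQ =>
    Measure.restrict_eq_self_of_ae_mem (by rw [ae_iff]; exact hQ)
  have hmap : ∀ Q : Measure ℂ, Q Kᶜ = 0 → (Q.comap (Subtype.val : K → ℂ)).map Subtype.val = Q :=
    fun Q hQ => by
      rw [map_comap_subtype_coe hKm, hrestr Q hQ]
  have hfin : ∀ Q : Measure ℂ, IsFiniteMeasure Q →
      IsFiniteMeasure (Q.comap (Subtype.val : K → ℂ)) := fun Q hQ => by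
    constructor
    rw [comap_subtype_coe_apply hKm]
    exact measure_lt_top _ _
  have := hfin P inferInstance
  have := hfin P' inferInstance
  suffices hcm : P.comap (Subtype.val : K → ℂ) = P'.comap Subtype.val by
    rw [← hmap P hP, ← hmap P' hP', hcm]
  -- The star-algebra generated by the inclusion separates points of the compact disc, as
  -- Stone–Weierstrass requires, and is spanned by the monomials `f ^ a * star f ^ b`.
  set f : BoundedContinuousFunction K ℂ :=
    BoundedContinuousFunction.mkOfCompact ⟨Subtype.val, continuous_subtype_val⟩ with hf
  refine ext_of_forall_mem_subalgebra_integral_eq_of_polish (𝕜 := ℂ)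
    (A := StarAlgebra.adjoin ℂ {f}) ?_ ?_
  · intro x y hxy
    refine ⟨f, ⟨BoundedContinuousFunction.toContinuousMapStarₐ ℂ f,
      ⟨f, StarAlgebra.subset_adjoin ℂ {f} rfl, rfl⟩, rfl⟩, ?_⟩
    simpa [hf] using fun h => hxy (Subtype.ext h)
  · intro g hg
    have hg' : g ∈ (StarAlgebra.adjoin ℂ {f}).toSubalgebra := hg
    rw [StarAlgebra.adjoin_toSubalgebra, ← Subalgebra.mem_toSubmodule, Algebra.adjoin_eq_span] at hg'
    have hint : ∀ (Q : Measure ℂ), IsFiniteMeasure Q → ∀ g : BoundedContinuousFunction K ℂ,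
        Integrable g (Q.comap (Subtype.val : K → ℂ)) := by
      intro Q hQ g
      have := hfin Q hQ
      exact g.integrable _
    clear hg
    induction hg' using Submodule.span_induction with
    | mem x hx =>
      rw [Set.star_singleton, Set.singleton_union, SetLike.mem_coe, Submonoid.mem_closure_pair] at hx
      obtain ⟨a, b, rfl⟩ := hx
      have hQ : ∀ Q : Measure ℂ, Q Kᶜ = 0 →
          ∫ x, (f ^ a * star f ^ b : BoundedContinuousFunction K ℂ) x ∂(Q.comap (Subtype.val : K → ℂ)) =
          ∫ z, z ^ a * (conj z) ^ b ∂Q := by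
        intro Q hQ
        conv_rhs => rw [← hrestr Q hQ]
        rw [← integral_subtype_comap hKm (fun z : ℂ => z ^ a * (conj z) ^ b)]
        rfl
      rw [hQ P hP, hQ P' hP', h]
    | zero => simp
    | add x y _ _ hx hy =>
      simp only [BoundedContinuousFunction.coe_add, Pi.add_apply]
      rw [integral_add (hint P inferInstance x) (hint P inferInstance y),
        integral_add (hint P' inferInstance x) (hint P' inferInstance y), hx, hy]
    | smul c x _ hx =>
      simp only [BoundedContinuousFunction.coe_smul]
      rw [integral_smul, integral_smul, hx]

open scoped ComplexConjugate in
theorem integral_eq_zero_of_rotation {P : Measure ℂ}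
    (hP : ∀ θ : ℝ, P.map (fun z => Complex.exp (Complex.I * θ) * z) = P) {a b : ℕ} (hab : a ≠ b)
    (g : ℂ → ℂ)
    (hg : ∀ (θ : ℝ) z, g (Complex.exp (Complex.I * θ) * z) =
      Complex.exp (Complex.I * θ) ^ a * conj (Complex.exp (Complex.I * θ)) ^ b * g z) :
    ∫ z, g z ∂P = 0 := by
  have hab' : (a : ℂ) - b ≠ 0 := sub_ne_zero.2 (by exact_mod_cast hab)
  -- This angle makes the rotation factor `e^{iθ(a-b)}` equal to `-1`.
  set θ : ℝ := Real.pi / ((a : ℝ) - b) with hθ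
  have hm : MeasurableEmbedding (fun z : ℂ => Complex.exp (Complex.I * θ) * z) :=
    (Homeomorph.mulLeft₀ _ (Complex.exp_ne_zero _)).measurableEmbedding
  have h1 : ∫ z, g z ∂P = ∫ z, g (Complex.exp (Complex.I * θ) * z) ∂P := by
    conv_lhs => rw [← hP θ]
    rw [hm.integral_map]
  have h2 : Complex.exp (Complex.I * θ) ^ a * conj (Complex.exp (Complex.I * θ)) ^ b = -1 := by
    rw [← Complex.exp_conj, ← Complex.exp_nat_mul, ← Complex.exp_nat_mul, ← Complex.exp_add,
      ← Complex.exp_pi_mul_I]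
    congr 1
    simp only [map_mul, Complex.conj_I, Complex.conj_ofReal, hθ]
    push_cast
    field_simp
    ring
  simp only [hg, h2, neg_one_mul, integral_neg] at h1
  exact self_eq_neg.1 h1

open scoped ComplexConjugate in
/-- For a rotation-invariant law the moments of the real part are determined by those of `|z|²`. -/
theorem integral_re_pow_of_rotation {P : Measure ℂ}
    (hP : ∀ θ : ℝ, P.map (fun z => Complex.exp (Complex.I * θ) * z) = P)
    (hint : ∀ a b : ℕ, Integrable (fun z : ℂ => z ^ a * conj z ^ b) P) (m : ℕ) :
    ((∫ z : ℂ, z.re ^ m ∂P : ℝ) : ℂ) =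
      ∑ j ∈ Finset.range (m + 1), if j = m - j then
        (2 ^ m)⁻¹ * (m.choose j : ℂ) * ∫ z : ℂ, z ^ j * conj z ^ j ∂P else 0 := by
  have h1 : ∀ z : ℂ, ((z.re ^ m : ℝ) : ℂ) =
      ∑ j ∈ Finset.range (m + 1), (2 ^ m)⁻¹ * (m.choose j : ℂ) * (z ^ j * conj z ^ (m - j)) := by
    intro z
    rw [Complex.ofReal_pow, Complex.re_eq_add_conj, div_pow, add_pow, Finset.sum_div]
    refine Finset.sum_congr rfl fun j _ => ?_
    ring
  rw [← integral_complex_ofReal]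
  simp only [h1]
  rw [integral_finsetSum _ fun j _ => (hint _ _).const_mul _]
  refine Finset.sum_congr rfl fun j _ => ?_
  rw [integral_const_mul]
  split_ifs with hj
  · rw [← hj]
  · rw [integral_eq_zero_of_rotation hP hj, mul_zero]
    intro θ z
    simp only [map_mul, mul_pow]
    ring

open scoped ComplexConjugate in
theorem integral_re_pow_odd {P : Measure ℂ}
    (hP : ∀ θ : ℝ, P.map (fun z => Complex.exp (Complex.I * θ) * z) = P)
    (hint : ∀ a b : ℕ, Integrable (fun z : ℂ => z ^ a * conj z ^ b) P) {m : ℕ} (hm : Odd m) :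
    ∫ z : ℂ, z.re ^ m ∂P = 0 := by
  have h := integral_re_pow_of_rotation hP hint m
  rw [Finset.sum_eq_zero] at h
  · exact_mod_cast h
  · intro j hj
    rw [if_neg]
    intro h
    obtain ⟨k, rfl⟩ := hm
    have := Finset.mem_range.1 hj
    omega

-- Only the central term of the binomial expansion of `((z + conj z)/2)^{2n}` survives averaging
-- over rotations.
open scoped ComplexConjugate in
theorem integral_re_pow_even {P : Measure ℂ}
    (hP : ∀ θ : ℝ, P.map (fun z => Complex.exp (Complex.I * θ) * z) = P)
    (hint : ∀ a b : ℕ, Integrable (fun z : ℂ => z ^ a * conj z ^ b) P) (n : ℕ) :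
    ((∫ z : ℂ, z.re ^ (2 * n) ∂P : ℝ) : ℂ) =
      (4 ^ n)⁻¹ * ((2 * n).choose n : ℂ) * ∫ z : ℂ, z ^ n * conj z ^ n ∂P := by
  rw [integral_re_pow_of_rotation hP hint, Finset.sum_eq_single n]
  · rw [if_pos (by omega), pow_mul]
    norm_num
  · intro j _ hj
    rw [if_neg (by omega)]
  · simp; omega

theorem integrable_comp_normSq_div {F : ℝ → ℝ} (hF : IntegrableOn F (Set.Ioi 0)) {c : ℝ}
    (hc : 0 < c) : Integrable (fun z : ℂ => F (‖z‖ ^ 2 / c)) := by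
  rw [integrable_fun_norm_addHaar volume (f := fun r => F (r ^ 2 / c)), Complex.finrank_real_complex]
  have h1 : IntegrableOn (fun t => F (t / c)) (Set.Ioi 0) := by
    have := (integrableOn_Ioi_comp_mul_left_iff F 0 (inv_pos.2 hc)).2 (by simpa using hF)
    simpa [div_eq_inv_mul] using this
  have h2 := (integrableOn_Ioi_comp_rpow_iff' (fun t => F (t / c)) two_ne_zero).2 h1
  refine h2.congr_fun (fun x _ => ?_) measurableSet_Ioi
  norm_num

/-- Polar coordinates with `t = r²`, for which `2π r dr = π dt`, then `t = c x`. -/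
theorem integral_norm_pow_mul_comp_normSq_div (F : ℝ → ℝ) {c : ℝ} (hc : 0 < c) (n : ℕ) :
    ∫ z : ℂ, ‖z‖ ^ (2 * n) * F (‖z‖ ^ 2 / c) =
      Real.pi * c ^ (n + 1) * ∫ x in Set.Ioi (0 : ℝ), x ^ n * F x := by
  rw [integral_fun_norm_addHaar volume (fun r => r ^ (2 * n) * F (r ^ 2 / c)),
    Complex.finrank_real_complex]
  have hball : (volume : Measure ℂ).real (Metric.ball 0 1) = Real.pi := by
    simp [Measure.real, Complex.volume_ball]
  rw [hball]
  have h1 := integral_comp_rpow_Ioi_of_pos (g := fun t => t ^ n * F (t / c)) two_pos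
  have h2 := integral_comp_mul_left_Ioi' (fun t => t ^ n * F (t / c)) 0 hc
  rw [mul_zero] at h2
  have h3 : ∫ y in Set.Ioi (0 : ℝ), y ^ (2 - 1) • (y ^ (2 * n) * F (y ^ 2 / c)) =
      2⁻¹ * ∫ t in Set.Ioi (0 : ℝ), t ^ n * F (t / c) := by
    rw [← h1, ← integral_const_mul]
    refine setIntegral_congr_fun measurableSet_Ioi fun x _ => ?_
    norm_num
    ring
  have h4 : ∫ x in Set.Ioi (0 : ℝ), (c * x) ^ n * F (c * x / c) =
      c ^ n * ∫ x in Set.Ioi (0 : ℝ), x ^ n * F x := by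
    rw [← integral_const_mul]
    refine setIntegral_congr_fun measurableSet_Ioi fun x _ => ?_
    simp only [mul_div_cancel_left₀ _ hc.ne']
    ring
  rw [h3, ← h2, h4]
  simp only [smul_eq_mul, nsmul_eq_mul]
  push_cast
  ring

theorem map_rotation_volume (θ : ℝ) :
    (volume : Measure ℂ).map (fun z => Complex.exp (Complex.I * θ) * z) = volume := by
  have h : MeasurePreserving (rotation (Circle.exp θ)) := (rotation (Circle.exp θ)).measurePreserving
  have h2 : (fun z => Complex.exp (Complex.I * θ) * z) = rotation (Circle.exp θ) := by
    ext z
    simp [rotation_apply, mul_comm]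
  rw [h2]
  exact h.map_eq

open scoped ComplexConjugate in
/-- A signed radial density with the same moments as a finite measure is the density of it. -/
theorem ae_nonneg_and_eq_withDensity_of_moments {P : Measure ℂ} [IsFiniteMeasure P] (R : ℝ)
    (hP : P (Metric.closedBall 0 R)ᶜ = 0) (f : ℂ → ℝ) (hf : Integrable f)
    (hfR : ∀ z, z ∉ Metric.closedBall (0 : ℂ) R → f z = 0)
    (hfin : ∀ a b : ℕ, Integrable (fun z => z ^ a * conj z ^ b) P)
    (hfint : ∀ a b : ℕ, Integrable (fun z => (f z : ℂ) * (z ^ a * conj z ^ b)))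
    (h : ∀ a b : ℕ, ∫ z, z ^ a * conj z ^ b ∂P = ∫ z, (f z : ℂ) * (z ^ a * conj z ^ b)) :
    (∀ᵐ z, 0 ≤ f z) ∧ P = volume.withDensity (fun z => ENNReal.ofReal (f z)) := by
  have hmeas : AEMeasurable f := hf.aemeasurable
  have hmeasn : AEMeasurable (fun z => -f z) := hmeas.neg
  set Qp : Measure ℂ := volume.withDensity (fun z => ENNReal.ofReal (f z)) with hQp
  set Qn : Measure ℂ := volume.withDensity (fun z => ENNReal.ofReal (-f z)) with hQn
  have hQpf : IsFiniteMeasure Qp := isFiniteMeasure_withDensity_ofReal hf.2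
  have hQnf : IsFiniteMeasure Qn := isFiniteMeasure_withDensity_ofReal hf.neg.2
  have hKm : MeasurableSet (Metric.closedBall (0 : ℂ) R)ᶜ :=
    Metric.isClosed_closedBall.measurableSet.compl
  have hsp : Qp (Metric.closedBall 0 R)ᶜ = 0 := by
    rw [hQp, withDensity_apply _ hKm]
    exact setLIntegral_eq_zero hKm fun z hz => by simp [hfR z hz]
  have hsn : Qn (Metric.closedBall 0 R)ᶜ = 0 := by
    rw [hQn, withDensity_apply _ hKm]
    exact setLIntegral_eq_zero hKm fun z hz => by simp [hfR z hz]
  have hip : ∀ g : ℂ → ℂ, ∫ z, g z ∂Qp = ∫ z, ((max (f z) 0 : ℝ) : ℂ) * g z := by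
    intro g
    rw [hQp, integral_withDensity_eq_integral_toReal_smul₀ hmeas.ennreal_ofReal (by simp)]
    refine integral_congr_ae (.of_forall fun z => ?_)
    simp only [ENNReal.toReal_ofReal', Complex.real_smul]
  have hin : ∀ g : ℂ → ℂ, ∫ z, g z ∂Qn = ∫ z, ((max (-f z) 0 : ℝ) : ℂ) * g z := by
    intro g
    rw [hQn, integral_withDensity_eq_integral_toReal_smul₀ hmeasn.ennreal_ofReal (by simp)]
    refine integral_congr_ae (.of_forall fun z => ?_)
    simp only [ENNReal.toReal_ofReal', Complex.real_smul]
  have hmint : ∀ (u : ℂ → ℝ), AEMeasurable u → (∀ z, |u z| ≤ |f z|) → ∀ a b : ℕ,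
      Integrable (fun z => (u z : ℂ) * (z ^ a * conj z ^ b)) := by
    intro u hu huf a b
    refine (hfint a b).mono ?_ (.of_forall fun z => ?_)
    · exact (Complex.measurable_ofReal.comp_aemeasurable hu).aestronglyMeasurable.mul
        (Continuous.aestronglyMeasurable (by fun_prop))
    · rw [norm_mul _ (z ^ a * _), norm_mul (f z : ℂ), Complex.norm_real, Complex.norm_real]
      exact mul_le_mul_of_nonneg_right (huf z) (norm_nonneg _)
  have hup := hmint (fun z => max (f z) 0) (hmeas.max aemeasurable_const) fun z => by
    rw [abs_of_nonneg (le_max_right _ _)]; exact max_le (le_abs_self _) (abs_nonneg _)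
  have hun := hmint (fun z => max (-f z) 0) (hmeasn.max aemeasurable_const) fun z => by
    rw [abs_of_nonneg (le_max_right _ _)]; exact max_le (neg_le_abs _) (abs_nonneg _)
  have hQnint : ∀ a b : ℕ, Integrable (fun z => z ^ a * conj z ^ b) Qn := by
    intro a b
    rw [hQn, integrable_withDensity_iff_integrable_smul₀' hmeasn.ennreal_ofReal (by simp)]
    refine (hun a b).congr (.of_forall fun z => ?_)
    simp only [ENNReal.toReal_ofReal', Complex.real_smul]
  -- With the negative part moved to the left, both sides are positive measures and moment
  -- determinacy applies.
  have heq : P + Qn = Qp := by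
    refine Measure.ext_of_complex_moments R ?_ hsp fun a b => ?_
    · rw [Measure.add_apply, hP, hsn, add_zero]
    · rw [integral_add_measure (hfin a b) (hQnint a b), hip, hin, h,
        ← integral_add (hfint a b) (hun a b)]
      refine integral_congr_ae (.of_forall fun z => ?_)
      simp only
      rw [← add_mul, ← Complex.ofReal_add]
      congr 2
      rcases le_total 0 (f z) with hz | hz
      · rw [max_eq_right (by linarith), max_eq_left hz, add_zero]
      · rw [max_eq_left (by linarith), max_eq_right hz, add_neg_cancel]
  -- Positivity of `P` gives `f⁻ ≤ f⁺` almost everywhere; the two are never both nonzero, so `f⁻ =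
  -- 0`.
  have hle : (fun z => ENNReal.ofReal (-f z)) ≤ᵐ[volume] fun z => ENNReal.ofReal (f z) := by
    refine ae_le_of_forall_setLIntegral_le_of_sigmaFinite₀ hmeasn.ennreal_ofReal fun s hs _ => ?_
    rw [← withDensity_apply _ hs, ← withDensity_apply _ hs, ← hQp, ← heq, Measure.add_apply]
    exact le_add_self
  have hnn : ∀ᵐ z, 0 ≤ f z := by
    filter_upwards [hle] with z hz
    by_contra! hneg
    rw [ENNReal.ofReal_of_nonpos hneg.le, nonpos_iff_eq_zero, ENNReal.ofReal_eq_zero] at hz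
    linarith
  refine ⟨hnn, ?_⟩
  have hQ0 : Qn = 0 := by
    rw [hQn, withDensity_eq_zero_iff hmeasn.ennreal_ofReal]
    filter_upwards [hnn] with z hz
    simpa using hz
  rw [← heq, hQ0, add_zero]

theorem nonneg_of_ae_nonneg_of_continuousAt {f : ℂ → ℝ} (h : ∀ᵐ z, 0 ≤ f z) {z : ℂ}
    (hz : ContinuousAt f z) : 0 ≤ f z := by
  by_contra! hneg
  have h1 : {w | f w < 0} ∈ nhds z := hz (gt_mem_nhds hneg)
  have h2 : volume {w | f w < 0} = 0 := by simpa [ae_iff] using h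
  exact (Measure.measure_pos_of_mem_nhds volume h1).ne' h2

/-! ### The numerical shadow and its real marginal. -/

section Shadow

variable {N : ℕ}

theorem continuous_quadForm (M : Matrix (Fin N) (Fin N) ℂ) : Continuous (quadForm M) := by
  unfold quadForm
  fun_prop

theorem measurable_quadForm_sphere (M : Matrix (Fin N) (Fin N) ℂ) :
    Measurable fun u : Metric.sphere (0 : EuclideanSpace ℂ (Fin N)) 1 => quadForm M u.val :=
  ((continuous_quadForm M).comp continuous_subtype_val).measurable

theorem isProbabilityMeasure_numericalShadow (hN : 0 < N) (M : Matrix (Fin N) (Fin N) ℂ) :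
    IsProbabilityMeasure (numericalShadow M) := by
  have := isProbabilityMeasure_uniformSphere hN
  exact Measure.isProbabilityMeasure_map (measurable_quadForm_sphere M).aemeasurable

theorem exists_numericalShadow_compl_closedBall_eq_zero (M : Matrix (Fin N) (Fin N) ℂ) :
    ∃ R₀ : ℝ, ∀ R, R₀ ≤ R → numericalShadow M (Metric.closedBall 0 R)ᶜ = 0 := by
  obtain ⟨R₀, hR₀⟩ := (isCompact_sphere (0 : EuclideanSpace ℂ (Fin N)) 1).exists_bound_of_continuousOn
    (continuous_quadForm M).continuousOn
  refine ⟨R₀, fun R hR => ?_⟩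
  rw [numericalShadow, Measure.map_apply (measurable_quadForm_sphere M)
    Metric.isClosed_closedBall.measurableSet.compl]
  convert measure_empty (μ := uniformSphere N)
  ext u
  simpa using (hR₀ u.1 u.2).trans hR

theorem quadForm_smul_matrix (c : ℂ) (M : Matrix (Fin N) (Fin N) ℂ) (u : EuclideanSpace ℂ (Fin N)) :
    quadForm (c • M) u = c * quadForm M u := by
  simp [quadForm, Matrix.smul_mulVec, dotProduct_smul]

theorem map_mul_numericalShadow (c : ℂ) (M : Matrix (Fin N) (Fin N) ℂ) :
    (numericalShadow M).map (fun z => c * z) = numericalShadow (c • M) := by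
  rw [numericalShadow, Measure.map_map (by fun_prop) (measurable_quadForm_sphere M), numericalShadow]
  simp only [Function.comp_def, quadForm_smul_matrix]

theorem quadForm_conjTranspose (M : Matrix (Fin N) (Fin N) ℂ) (u : EuclideanSpace ℂ (Fin N)) :
    quadForm Mᴴ u = star (quadForm M u) := by
  simp only [quadForm]
  rw [Matrix.dotProduct_mulVec, ← Matrix.star_mulVec, Matrix.star_dotProduct]

theorem re_quadForm_hermPart (M : Matrix (Fin N) (Fin N) ℂ) (u : EuclideanSpace ℂ (Fin N)) :
    (quadForm (hermPart M) u).re = (quadForm M u).re := by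
  have : quadForm (hermPart M) u = 2⁻¹ * (quadForm M u + star (quadForm M u)) := by
    rw [← quadForm_conjTranspose, hermPart, quadForm_smul_matrix]
    simp [quadForm, Matrix.add_mulVec, dotProduct_add]
  rw [this, Complex.star_def, Complex.add_conj]
  simp

open PowerSeries in
/-- Moments of the real part of the numerical shadow. -/
theorem integral_re_pow_numericalShadow (hN : 0 < N) (M : Matrix (Fin N) (Fin N) ℂ) (m : ℕ) :
    ∫ z, z.re ^ m ∂numericalShadow M = m.factorial * (N - 1).factorial / (N + m - 1).factorial *
      coeff m (∏ i, (1 - C ((hermPart_isHermitian M).eigenvalues i) * X : PowerSeries ℝ))⁻¹ := by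
  rw [← integral_uniformSphere_quadForm_pow hN, numericalShadow,
    integral_map (measurable_quadForm_sphere M).aemeasurable
      (Continuous.aestronglyMeasurable (by fun_prop))]
  simp only [re_quadForm_hermPart]

open scoped ComplexConjugate in
theorem integrable_pow_mul_conj_pow {P : Measure ℂ} [IsFiniteMeasure P] {R : ℝ}
    (hP : P (Metric.closedBall 0 R)ᶜ = 0) (a b : ℕ) : Integrable (fun z => z ^ a * conj z ^ b) P := by
  rw [← Measure.restrict_eq_self_of_ae_mem (μ := P) (s := Metric.closedBall 0 R)
    (by rw [ae_iff]; exact hP)]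
  exact ContinuousOn.integrableOn_compact (isCompact_closedBall 0 R) (by fun_prop)

open PowerSeries in
theorem eigenvalues_eq_zero_of_prod_eq_one {M : Matrix (Fin N) (Fin N) ℂ} (hM : M.IsHermitian)
    (h : ∏ i, (1 - C (hM.eigenvalues i) * X : PowerSeries ℝ) = 1) : M = 0 := by
  rw [← hM.eigenvalues_eq_zero_iff]
  have h1 := map_eq_of_prod_one_sub_eq hM.eigenvalues (fun _ => 0) (by rw [h]; simp)
  ext i
  have h2 : hM.eigenvalues i ∈ Finset.univ.val.map (fun _ : Fin N => (0 : ℝ)) := by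
    rw [← h1]; exact Multiset.mem_map_of_mem _ (Finset.mem_univ_val i)
  obtain ⟨_, _, h3⟩ := Multiset.mem_map.1 h2
  exact h3.symm

theorem eq_zero_of_hermPart_eq_zero {A : Matrix (Fin N) (Fin N) ℂ} (h1 : hermPart A = 0)
    (h2 : hermPart (Complex.I • A) = 0) : A = 0 := by
  have h3 : A + Aᴴ = 0 := by
    rw [hermPart] at h1
    exact (smul_eq_zero.1 h1).resolve_left (by norm_num)
  have h4 : A - Aᴴ = 0 := by
    rw [hermPart, Matrix.conjTranspose_smul, Complex.star_def, Complex.conj_I, neg_smul,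
      ← sub_eq_add_neg, ← smul_sub, smul_smul] at h2
    exact (smul_eq_zero.1 h2).resolve_left (by simp)
  have h5 : (2 : ℂ) • A = 0 := by
    rw [two_smul]
    calc A + A = (A + Aᴴ) + (A - Aᴴ) := by abel
      _ = 0 := by rw [h3, h4, add_zero]
  exact (smul_eq_zero.1 h5).resolve_left (by norm_num)

-- The moments of `Re z` under the shadow recover every coefficient of `1 / det(1 - X Re A)`, since
-- the factorial prefactor is nonzero.
open PowerSeries in
theorem prod_one_sub_eigenvalues_congr (hN : 0 < N) {A B : Matrix (Fin N) (Fin N) ℂ}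
    (h : numericalShadow A = numericalShadow B) :
    ∏ i, (1 - C ((hermPart_isHermitian A).eigenvalues i) * X : PowerSeries ℝ) =
      ∏ i, (1 - C ((hermPart_isHermitian B).eigenvalues i) * X : PowerSeries ℝ) := by
  have h1 : (∏ i, (1 - C ((hermPart_isHermitian A).eigenvalues i) * X : PowerSeries ℝ))⁻¹ =
      (∏ i, (1 - C ((hermPart_isHermitian B).eigenvalues i) * X : PowerSeries ℝ))⁻¹ := by
    ext m
    have h2 := integral_re_pow_numericalShadow hN A m
    rw [h, integral_re_pow_numericalShadow hN B m] at h2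
    exact (mul_left_cancel₀ (by positivity) h2).symm
  have hA : constantCoeff (∏ i, (1 - C ((hermPart_isHermitian A).eigenvalues i) * X : PowerSeries ℝ)) ≠ 0 := by
    simp [map_prod]
  have hB : constantCoeff (∏ i, (1 - C ((hermPart_isHermitian B).eigenvalues i) * X : PowerSeries ℝ)) ≠ 0 := by
    simp [map_prod]
  have h3 := congrArg (· * ∏ i, (1 - C ((hermPart_isHermitian B).eigenvalues i) * X : PowerSeries ℝ)) h1
  simp only [PowerSeries.inv_mul_cancel _ hB] at h3
  calc _ = _ * (_⁻¹ * _) := by rw [h3, mul_one]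
    _ = _ := by rw [← mul_assoc, PowerSeries.mul_inv_cancel _ hA, one_mul]

end Shadow

/-! ### The proposed density: integrability, moments and sign. -/

section RadialDensity

variable {N p : ℕ}

theorem radialDensity_eq_zero {lam : Fin p → ℝ} (h : ∀ k, 0 < lam k) {r R : ℝ}
    (hR : ∀ k, lam k ≤ R) (hr : R < r) : radialDensity N lam r = 0 := by
  rw [radialDensity, Finset.sum_eq_zero, mul_zero]
  intro k _
  rw [shadowF_of_one_le, mul_zero]
  rw [one_le_div (pow_pos (h k) 2)]
  exact pow_le_pow_left₀ (h k).le ((hR k).trans hr.le) 2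

theorem integrable_radialDensity (hN : 2 ≤ N) {lam : Fin p → ℝ} (h : ∀ k, 0 < lam k) :
    Integrable (fun z : ℂ => radialDensity N lam ‖z‖) := by
  refine (integrable_finsetSum _ fun k _ => ?_).const_mul _
  exact (integrable_comp_normSq_div (integrableOn_shadowF hN) (pow_pos (h k) 2)).const_mul _

theorem integrable_norm_pow_mul_shadowF (hN : 2 ≤ N) {c : ℝ} (hc : 0 < c) (n : ℕ) :
    Integrable (fun z : ℂ => ‖z‖ ^ (2 * n) * shadowF N (‖z‖ ^ 2 / c)) := by
  apply Integrable.of_integral_ne_zero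
  rw [integral_norm_pow_mul_comp_normSq_div _ hc, integral_pow_mul_shadowF hN]
  positivity

/-- Scaling contributes `(λ_k²)^{n+1}`, which raises the exponent `2(p-2)` of the density to the
`2(p-1) + 2n` of the partial fractions. -/
theorem integral_norm_pow_mul_radialDensity (hN : 2 ≤ N) {lam : Fin p → ℝ} (h : ∀ k, 0 < lam k)
    (n : ℕ) :
    ∫ z : ℂ, ‖z‖ ^ (2 * n) * radialDensity N lam ‖z‖ =
      4 ^ n * n.factorial ^ 2 * (N - 1).factorial / (N + 2 * n - 1).factorial *
        ∑ k, (lam k ^ 2) ^ (p - 1) / (∏ j ∈ Finset.univ.erase k, (lam k ^ 2 - lam j ^ 2)) *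
          (lam k ^ 2) ^ n := by
  have h1 : ∀ z : ℂ, ‖z‖ ^ (2 * n) * radialDensity N lam ‖z‖ = ∑ k, 1 / Real.pi *
      (lam k ^ (2 * ((p : ℤ) - 2)) / (∏ j ∈ Finset.univ.erase k, (lam k ^ 2 - lam j ^ 2))) *
        (‖z‖ ^ (2 * n) * shadowF N (‖z‖ ^ 2 / lam k ^ 2)) := by
    intro z
    rw [radialDensity, Finset.mul_sum, Finset.mul_sum]
    exact Finset.sum_congr rfl fun k _ => by ring
  simp only [h1]
  rw [integral_finsetSum _ fun k _ =>
    (integrable_norm_pow_mul_shadowF hN (pow_pos (h k) 2) n).const_mul _, Finset.mul_sum]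
  refine Finset.sum_congr rfl fun k _ => ?_
  have hp : 1 ≤ p := (Nat.zero_le _).trans_lt k.2
  rw [integral_const_mul, integral_norm_pow_mul_comp_normSq_div _ (pow_pos (h k) 2),
    integral_pow_mul_shadowF hN]
  have h2 : lam k ^ (2 * ((p : ℤ) - 2)) * (lam k ^ 2) ^ (n + 1) =
      (lam k ^ 2) ^ (p - 1) * (lam k ^ 2) ^ n := by
    rw [← pow_mul, ← pow_mul, ← pow_mul, ← pow_add, ← zpow_natCast, ← zpow_natCast,
      ← zpow_add₀ (h k).ne']
    congr 1
    push_cast [Nat.cast_sub hp]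
    ring
  have hpi := Real.pi_ne_zero
  calc _ = (4 ^ n * n.factorial ^ 2 * (N - 1).factorial / (N + 2 * n - 1).factorial) *
        ((lam k ^ (2 * ((p : ℤ) - 2)) * (lam k ^ 2) ^ (n + 1)) /
          (∏ j ∈ Finset.univ.erase k, (lam k ^ 2 - lam j ^ 2))) := by field_simp
    _ = _ := by rw [h2]; ring

theorem continuousAt_radialDensity (hN : 4 ≤ N) {lam : Fin p → ℝ} (h : ∀ k, 0 < lam k) {z : ℂ}
    (hz : z ≠ 0) : ContinuousAt (fun z : ℂ => radialDensity N lam ‖z‖) z := by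
  unfold radialDensity
  refine ContinuousAt.const_mul (tendsto_finsetSum _ fun k _ => ContinuousAt.const_mul ?_ _) _
  have h1 : 0 < ‖z‖ ^ 2 / lam k ^ 2 := by
    have := h k
    positivity
  exact ContinuousAt.comp (f := fun z : ℂ => ‖z‖ ^ 2 / lam k ^ 2) (continuousAt_shadowF hN h1)
    (by fun_prop)

/-- For `p ≤ 1` there is no sign-changing denominator. For `p ≥ 2` the bound `2p ≤ N` gives `N ≥ 4`,
hence continuity off the origin; at the origin the default value 0 of `shadowF` is used. -/
theorem radialDensity_nonneg_of_ae (hp : 2 * p ≤ N) (hN : 2 ≤ N) {lam : Fin p → ℝ}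
    (h : ∀ k, 0 < lam k) (hae : ∀ᵐ z : ℂ, 0 ≤ radialDensity N lam ‖z‖) (z : ℂ) :
    0 ≤ radialDensity N lam ‖z‖ := by
  rcases Nat.lt_or_ge p 2 with hp2 | hp2
  · refine mul_nonneg (by positivity) (Finset.sum_nonneg fun k _ => ?_)
    have : Finset.univ.erase k = ∅ := by
      rw [← Finset.card_eq_zero, Finset.card_erase_of_mem (Finset.mem_univ k)]
      simp
      omega
    rw [this, Finset.prod_empty, div_one]
    exact mul_nonneg (zpow_nonneg (h k).le _) (shadowF_nonneg hN (by positivity))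
  · rcases eq_or_ne z 0 with rfl | hz
    · have : radialDensity N lam ‖(0 : ℂ)‖ = 0 := by
        simp [radialDensity, shadowF_zero (show 3 ≤ N by omega)]
      rw [this]
    · exact nonneg_of_ae_nonneg_of_continuousAt hae (continuousAt_radialDensity (by omega) h hz)

open scoped ComplexConjugate in
theorem integrable_radialDensity_mul (hN : 2 ≤ N) {lam : Fin p → ℝ} (h : ∀ k, 0 < lam k) {R : ℝ}
    (hR : ∀ k, lam k ≤ R) (a b : ℕ) :
    Integrable (fun z : ℂ => (radialDensity N lam ‖z‖ : ℂ) * (z ^ a * conj z ^ b)) := by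
  have h1 := (integrable_radialDensity hN h).ofReal (𝕜 := ℂ)
  -- The density vanishes for `‖z‖ > R`, so the monomial may be bounded by `|R|^{a+b}`.
  refine (h1.mul_const ((R : ℂ) ^ (a + b))).mono ?_ (.of_forall fun z => ?_)
  · exact h1.aestronglyMeasurable.mul (Continuous.aestronglyMeasurable (by fun_prop))
  · rcases lt_or_ge R ‖z‖ with hz | hz
    · rw [radialDensity_eq_zero h hR hz]
      simp
    · rw [norm_mul, norm_mul, norm_mul, norm_pow, norm_pow, RCLike.norm_conj, ← pow_add, norm_pow,
        Complex.norm_real R]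
      exact mul_le_mul_of_nonneg_left
        (pow_le_pow_left₀ (norm_nonneg _) (hz.trans (le_abs_self R)) _) (norm_nonneg _)

end RadialDensity

/-! ### Comparison of moments. -/

open scoped ComplexConjugate in
theorem mul_conj_pow_eq (n : ℕ) (z : ℂ) : z ^ n * conj z ^ n = ((‖z‖ ^ (2 * n) : ℝ) : ℂ) := by
  rw [← mul_pow, Complex.mul_conj']
  push_cast
  rw [pow_mul]

open PowerSeries ComplexConjugate in
theorem proposition8p5 {N : ℕ} (A : Matrix (Fin N) (Fin N) ℂ) (hA : A ≠ 0)
    (hrot : HasRotationInvariantShadow A)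
    {p : ℕ} (lam : Fin p → ℝ) (hinj : Function.Injective lam)
    (hlam : posEigenvalues A = Finset.univ.val.map lam) :
    IsPlanarDensity (numericalShadow A) (fun z => radialDensity N lam ‖z‖) := by
  have hN : 0 < N := by
    rcases Nat.eq_zero_or_pos N with rfl | h
    · exact absurd (Subsingleton.elim A 0) hA
    · exact h
  have hprob := isProbabilityMeasure_numericalShadow hN A
  have hinv : ∀ θ : ℝ, (numericalShadow A).map (fun z => Complex.exp (Complex.I * θ) * z) =
      numericalShadow A := fun θ => by rw [map_mul_numericalShadow, hrot θ]
  obtain ⟨R₀, hR₀⟩ := exists_numericalShadow_compl_closedBall_eq_zero A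
  have hint : ∀ a b : ℕ, Integrable (fun z => z ^ a * conj z ^ b) (numericalShadow A) :=
    integrable_pow_mul_conj_pow (hR₀ R₀ le_rfl)
  have hpos : ∀ k, 0 < lam k := by
    intro k
    have hk : lam k ∈ posEigenvalues A := by
      rw [hlam]; exact Multiset.mem_map_of_mem _ (Finset.mem_univ_val k)
    exact (Multiset.mem_filter.1 hk).2
  have hodd : ∀ m, Odd m → coeff m
      (∏ i, (1 - C ((hermPart_isHermitian A).eigenvalues i) * X : PowerSeries ℝ))⁻¹ = 0 := by
    intro m hm
    have h1 := integral_re_pow_numericalShadow hN A m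
    rw [integral_re_pow_odd hinv hint hm] at h1
    exact (mul_eq_zero.1 h1.symm).resolve_left (by positivity)
  obtain ⟨hpN, hprod⟩ := prod_one_sub_of_symmetric _ lam hlam (map_neg_eq_of_coeff_odd _ hodd)
  have hp : 0 < p := by
    -- With no positive eigenvalue, symmetry gives `det(1 - X Re A) = 1`, so `Re A = 0`. The quarter
    -- turn `iA` has the same shadow, so `Re (iA) = 0` too, and `A = 0`.
    rcases Nat.eq_zero_or_pos p with rfl | h
    · refine absurd ?_ hA
      rw [Finset.univ_eq_empty (α := Fin 0), Finset.prod_empty] at hprod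
      refine eq_zero_of_hermPart_eq_zero
        (eigenvalues_eq_zero_of_prod_eq_one (hermPart_isHermitian A) hprod)
        (eigenvalues_eq_zero_of_prod_eq_one (hermPart_isHermitian _) ?_)
      refine (prod_one_sub_eigenvalues_congr hN ?_).trans hprod
      have h1 := hrot (Real.pi / 2)
      have h2 : Complex.exp (Complex.I * ((Real.pi / 2 : ℝ) : ℂ)) = Complex.I := by
        rw [mul_comm]; push_cast; exact Complex.exp_pi_div_two_mul_I
      rwa [h2] at h1
    · exact h
  have hN2 : 2 ≤ N := by omega
  have hpne : Nonempty (Fin p) := ⟨⟨0, hp⟩⟩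
  have hmu : Function.Injective (fun k => lam k ^ 2) := fun i j hij =>
    hinj ((pow_left_inj₀ (hpos i).le (hpos j).le two_ne_zero).1 hij)
  obtain ⟨R₁, hR₁⟩ : ∃ R₁, ∀ k, lam k ≤ R₁ := by
    obtain ⟨R₁, h⟩ := (Set.finite_range lam).bddAbove
    exact ⟨R₁, fun k => h ⟨k, rfl⟩⟩
  set R := max R₀ R₁ with hR
  have hlamR : ∀ k, lam k ≤ R := fun k => (hR₁ k).trans (le_max_right _ _)
  have hfint := integrable_radialDensity_mul hN2 hpos hlamR
  have hmoments : ∀ a b : ℕ, ∫ z, z ^ a * conj z ^ b ∂numericalShadow A =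
      ∫ z : ℂ, (radialDensity N lam ‖z‖ : ℂ) * (z ^ a * conj z ^ b) := by
    intro a b
    rcases eq_or_ne a b with rfl | hab
    · have h1 := integral_re_pow_even hinv hint a
      rw [integral_re_pow_numericalShadow hN, hprod,
        coeff_inv_prod_one_sub_sq (fun k => lam k ^ 2) hmu (fun k => (pow_pos (hpos k) 2).ne'),
        Fintype.card_fin] at h1
      have h2 := integral_norm_pow_mul_radialDensity hN2 hpos a
      have h3 : ∫ z : ℂ, (radialDensity N lam ‖z‖ : ℂ) * (z ^ a * conj z ^ a) =
          ((∫ z : ℂ, ‖z‖ ^ (2 * a) * radialDensity N lam ‖z‖ : ℝ) : ℂ) := by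
        rw [← integral_complex_ofReal]
        refine integral_congr_ae (.of_forall fun z => ?_)
        simp only [mul_conj_pow_eq]
        push_cast
        ring
      rw [h3, h2]
      have hch : ((2 * a).choose a : ℂ) * (a.factorial : ℂ) * (a.factorial : ℂ) = (2 * a).factorial := by
        have := Nat.choose_mul_factorial_mul_factorial (show a ≤ 2 * a by omega)
        rw [show 2 * a - a = a by omega] at this
        exact_mod_cast this
      have hch0 : ((2 * a).choose a : ℂ) ≠ 0 := by
        exact_mod_cast (Nat.choose_pos (show a ≤ 2 * a by omega)).ne'
      have h4 : (4 : ℂ) ^ a ≠ 0 := pow_ne_zero _ (by norm_num)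
      -- This solves `integral_re_pow_even` for the radial moment; the factor `4^a / C(2a, a)` turns
      -- `(2a)!` into `4^a a!²`, as in the moments of `shadowF`.
      have h5 : ∫ z, z ^ a * conj z ^ a ∂numericalShadow A = 4 ^ a / ((2 * a).choose a : ℂ) *
          ((4 ^ a)⁻¹ * ((2 * a).choose a : ℂ) * ∫ z, z ^ a * conj z ^ a ∂numericalShadow A) := by
        field_simp
      rw [h5, ← h1, Complex.ofReal_mul, Complex.ofReal_mul, ← mul_assoc]
      congr 1
      push_cast
      rw [← hch]
      field_simp
    · rw [integral_eq_zero_of_rotation hinv hab, integral_eq_zero_of_rotation map_rotation_volume hab]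
      · intro θ z
        have : ‖Complex.exp (Complex.I * θ) * z‖ = ‖z‖ := by
          rw [norm_mul, mul_comm Complex.I, Complex.norm_exp_ofReal_mul_I, one_mul]
        simp only [this, map_mul, mul_pow]
        ring
      · intro θ z
        simp only [map_mul, mul_pow]
        ring
  obtain ⟨hae, heq⟩ := ae_nonneg_and_eq_withDensity_of_moments R (hR₀ R (le_max_left _ _))
    (fun z => radialDensity N lam ‖z‖) (integrable_radialDensity hN2 hpos)
    (fun z hz => radialDensity_eq_zero hpos hlamR (by simpa using hz)) hint hfint hmoments
  exact ⟨radialDensity_nonneg_of_ae hpN hN2 hpos hae, integrable_radialDensity hN2 hpos, heq⟩
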